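/- Let $\Omega=\mathbb{R}\times[-1,1]$. For a vorticity $\omega:\Omega\to\mathbb{R}$ let $\psi$ be its stream function, i.e. the bounded solution of $-\Delta\psi=\omega$ in $\mathbb{R}\times(-1,1)$, $\psi=0$ on $\{y=\pm1\}$, and let $u=(u^x,u^y)=(\partial_y\psi,-\partial_x\psi)$ be the velocity it generates. A function $\omega=\omega(x,y)$ is called a traveling wave of speed $c\in\mathbb{R}$ if $w(t,x,y)=\omega(x-ct,y)$ solves the two-dimensional Euler equations near the Couette flow $(y,0)$, $$\partial_t w+y\,\partial_x w+u\cdot\nabla w=0\quad\text{in }\Omega,$$ where $u$ is generated by $w(t,\cdot)$; equivalently $(y-c+u^x)\partial_x\omega+u^y\partial_y\omega=0$ with $u$ generated by $\omega$. For $\alpha>0$ put $$\|\omega\|_{C^{1,\alpha}(\Omega)}=\sup_\Omega|\omega|+\sup_\Omega|\nabla\omega|+\sup_{z\neq z'}\frac{|\nabla\omega(z)-\nabla\omega(z')|}{|z-z'|^\alpha}.$$ **Theorem (Rigidity: Hölder scale).** For every $\alpha>0$ there exists $\epsilon_\alpha>0$, depending only on $\alpha$, such that the following holds. If $c\in\mathbb{R}$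 and $\omega\in C^{1,\alpha}(\Omega)\cap L^2(\Omega)$ is a traveling wave of speed $c$ with $$\|\omega\|_{C^{1,\alpha}(\Omega)}\le\epsilon_\alpha,$$ then $\omega\equiv0$ on $\Omega$. -/

import Mathlib

open MeasureTheory Set
open scoped ENNReal

noncomputable section

namespace Couette

/-- The closed infinite channel `ℝ × [-1, 1]`. -/
def channel : Set (ℝ × ℝ) := univ ×ˢ Icc (-1) 1

/-- The open channel `ℝ × (-1, 1)`. -/
def openChannel : Set (ℝ × ℝ) := univ ×ˢ Ioo (-1) 1

/-- The horizontal partial derivative. It is only evaluated at points of the open channel. -/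
def dx (f : ℝ × ℝ → ℝ) (z : ℝ × ℝ) : ℝ := fderiv ℝ f z (1, 0)

/-- The vertical partial derivative. It is only evaluated at points of the open channel. -/
def dy (f : ℝ × ℝ → ℝ) (z : ℝ × ℝ) : ℝ := fderiv ℝ f z (0, 1)

/-- The Euclidean length of a vector of the plane (the norm that Mathlib puts on `ℝ × ℝ` is the
maximum norm). -/
def euclid (v : ℝ × ℝ) : ℝ := Real.sqrt (v.1 ^ 2 + v.2 ^ 2)

/-- The gradient `(∂ₓ f, ∂_y f)`. -/
def grad (f : ℝ × ℝ → ℝ) (z : ℝ × ℝ) : ℝ × ℝ := (dx f z, dy f z)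

/-- The norm
`‖f‖_{C^{1,α}} = sup |f| + sup |∇f| + sup_{z ≠ z'} |∇f(z) - ∇f(z')| / |z - z'|^α`,
with values in `[0, ∞]`. -/
def holderNorm (α : ℝ) (f : ℝ × ℝ → ℝ) : ℝ≥0∞ :=
  (⨆ z ∈ channel, ENNReal.ofReal |f z|)
    + (⨆ z ∈ openChannel, ENNReal.ofReal (euclid (grad f z)))
    + ⨆ z ∈ openChannel, ⨆ z' ∈ openChannel, ⨆ _ : z ≠ z',
        ENNReal.ofReal (euclid (grad f z - grad f z') / euclid (z - z') ^ α)

/-- Membership in `C^{1,α}` of the closed channel: `f` is continuous up to the boundary, `C¹` inside,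
and its `C^{1,α}` norm is finite (so that the gradient extends continuously to the boundary). -/
structure MemHolder (α : ℝ) (f : ℝ × ℝ → ℝ) : Prop where
  continuousOn : ContinuousOn f channel
  contDiffOn : ContDiffOn ℝ 1 f openChannel
  norm_lt_top : holderNorm α f < ∞

/-- `ψ` is the stream function of the vorticity `ω`: the bounded classical solution of the Dirichlet
problem `-Δψ = ω` in the open channel, `ψ = 0` on `y = ±1`. Boundedness singles out the potential of
`ω` for the Dirichlet Green function among all solutions, such as those that differ from it by a
multiple of `exp (π x / 2) * cos (π y / 2)`. -/
structure IsStreamFunction (ω ψ : ℝ × ℝ → ℝ) : Prop where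
  contDiffOn : ContDiffOn ℝ 2 ψ openChannel
  continuousOn : ContinuousOn ψ channel
  bounded : ∃ M : ℝ, ∀ z ∈ channel, |ψ z| ≤ M
  bottom : ∀ x : ℝ, ψ (x, -1) = 0
  top : ∀ x : ℝ, ψ (x, 1) = 0
  poisson : ∀ z ∈ openChannel, -(dx (dx ψ) z + dy (dy ψ) z) = ω z

/-- The velocity `∇^⊥ ψ = (∂_y ψ, -∂ₓ ψ)`. -/
def velocity (ψ : ℝ × ℝ → ℝ) (z : ℝ × ℝ) : ℝ × ℝ := (dy ψ z, -dx ψ z)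

/-- `w` is a classical solution of the two-dimensional Euler equations for vorticity perturbations
of the Couette flow `(y, 0)`, that is `∂ₜ w + y ∂ₓ w + u · ∇ w = 0`, where `u` is the velocity
generated by `w`. -/
def IsEulerSolution (w : ℝ → ℝ × ℝ → ℝ) : Prop :=
  ContDiffOn ℝ 1 (fun p : ℝ × (ℝ × ℝ) => w p.1 p.2) (univ ×ˢ openChannel) ∧
  ∃ ψ : ℝ → ℝ × ℝ → ℝ,
    (∀ t : ℝ, IsStreamFunction (w t) (ψ t)) ∧
    ∀ t : ℝ, ∀ z ∈ openChannel,
      deriv (fun τ => w τ z) t + z.2 * dx (w t) z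
        + ((velocity (ψ t) z).1 * dx (w t) z + (velocity (ψ t) z).2 * dy (w t) z) = 0

/-- `ω` is the profile of a traveling wave of speed `c`: `ω (x - c t, y)` solves the equation. -/
def IsTravelingWave (c : ℝ) (ω : ℝ × ℝ → ℝ) : Prop :=
  IsEulerSolution (fun t z => ω (z.1 - c * t, z.2))

end Couette

end

/-!
The horizontal derivative `φ = ∂ₓψ` of the stream function solves `-Δφ = ∂ₓω` and vanishes on the
walls. If `ω` has `C^{1,α}` norm at most `ε`, the maximum principle with quadratic barriers gives
`|φ| ≤ ε (1 - y²) / 2` and, applied to odd reflections, `|∂ₓφ| ≤ ε`; hence `|∂_y ∂_y ψ| ≤ 2 ε`, and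
`p = y - c + ∂_y ψ` is strictly increasing on every vertical line. The traveling wave equation is
`p ∂ₓω = φ ∂_y ω`. At a zero `Y` of `p` either `φ` or `∂_y ω` vanishes, so the energy of `φ` or the
Hölder continuity of `∂_y ω` tames the singularity of `1 / p` up to the integrable weight
`|y - Y| ^ (α - 1)`. This bounds `∫ |φ ∂ₓω|` by `C ε ∫ (∂_y φ)²` on every vertical line, and for
small `ε` the energy identity `∫ |∇φ|² = ∫ φ ∂ₓω` forces `φ = 0`. Then `ψ`, and with it `ω`, does
not depend on `x`, and integrability leaves only `ω = 0`.
-/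

noncomputable section

namespace Couette

open Filter Topology

section DirectionalDerivative

variable {E : Type*} [NormedAddCommGroup E] [NormedSpace ℝ E] {f g : E → ℝ} {U : Set E} {z : E}

/-- The derivative of `f` in the direction `v`, so that `dx` and `dy` are the cases `v = (1, 0)` and
`v = (0, 1)`. -/
def dirDeriv (v : E) (f : E → ℝ) (z : E) : ℝ := fderiv ℝ f z v

lemma contDiffOn_dirDeriv {m n : WithTop ℕ∞} (hf : ContDiffOn ℝ n f U) (hU : IsOpen U)
    (hmn : m + 1 ≤ n) (v : E) : ContDiffOn ℝ m (dirDeriv v f) U :=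
  (hf.fderiv_of_isOpen hU hmn).clm_apply contDiffOn_const

lemma contDiff_dirDeriv {m n : WithTop ℕ∞} (hf : ContDiff ℝ n f) (hmn : m + 1 ≤ n) (v : E) :
    ContDiff ℝ m (dirDeriv v f) :=
  (hf.fderiv_right hmn).clm_apply contDiff_const

lemma continuousOn_dirDeriv (hf : ContDiffOn ℝ 1 f U) (hU : IsOpen U) (v : E) :
    ContinuousOn (dirDeriv v f) U :=
  (contDiffOn_dirDeriv (m := 0) hf hU (by norm_num) v).continuousOn

lemma differentiableAt_of_contDiffOn {n : WithTop ℕ∞} (hf : ContDiffOn ℝ n f U) (hU : IsOpen U)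
    (hn : n ≠ 0) (hz : z ∈ U) : DifferentiableAt ℝ f z :=
  (hf.differentiableOn hn).differentiableAt (hU.mem_nhds hz)

lemma dirDeriv_congr (hU : IsOpen U) (h : EqOn f g U) (v : E) :
    EqOn (dirDeriv v f) (dirDeriv v g) U := fun z hz => by
  simp only [dirDeriv, (h.eventuallyEq_of_mem (hU.mem_nhds hz)).fderiv_eq]

lemma dirDeriv_add (hf : DifferentiableAt ℝ f z) (hg : DifferentiableAt ℝ g z) (v : E) :
    dirDeriv v (fun x => f x + g x) z = dirDeriv v f z + dirDeriv v g z := by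
  simp only [dirDeriv, fderiv_fun_add hf hg, _root_.add_apply]

lemma dirDeriv_neg (f : E → ℝ) (v : E) :
    dirDeriv v (fun x => -f x) = fun x => -dirDeriv v f x := by
  funext z
  simp [dirDeriv, fderiv_fun_neg]

lemma dirDeriv_sub (hf : DifferentiableAt ℝ f z) (hg : DifferentiableAt ℝ g z) (v : E) :
    dirDeriv v (fun x => f x - g x) z = dirDeriv v f z - dirDeriv v g z := by
  simp only [dirDeriv, fderiv_fun_sub hf hg, _root_.sub_apply]

lemma dirDeriv_const_mul (c : ℝ) (f : E → ℝ) (v : E) :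
    dirDeriv v (fun x => c * f x) = fun x => c * dirDeriv v f x := by
  funext z
  have : (fun x => c * f x) = c • f := rfl
  simp [dirDeriv, this, fderiv_const_smul_field]

lemma dirDeriv_mul (hf : DifferentiableAt ℝ f z) (hg : DifferentiableAt ℝ g z) (v : E) :
    dirDeriv v (fun x => f x * g x) z = f z * dirDeriv v g z + dirDeriv v f z * g z := by
  simp only [dirDeriv, fderiv_fun_mul hf hg, _root_.add_apply, _root_.smul_apply, smul_eq_mul]
  ring

lemma dirDeriv_comp_add_right (f : E → ℝ) (a v : E) :
    dirDeriv v (fun x => f (x + a)) = fun x => dirDeriv v f (x + a) := by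
  funext z
  simp [dirDeriv, fderiv_comp_add_right]

lemma dirDeriv_comp_linearEquiv (L : E ≃L[ℝ] E) (f : E → ℝ) (v : E) :
    dirDeriv v (fun x => f (L x)) = fun x => dirDeriv (L v) f (L x) := by
  funext z
  simp only [dirDeriv, show (fun x => f (L x)) = f ∘ L from rfl, L.comp_right_fderiv]
  rfl

lemma dirDeriv_neg_left (f : E → ℝ) (v : E) : dirDeriv (-v) f = fun x => -dirDeriv v f x := by
  funext z
  simp only [dirDeriv, map_neg]

lemma dirDeriv_dirDeriv_add (hU : IsOpen U) (hf : ContDiffOn ℝ 2 f U) (hg : ContDiffOn ℝ 2 g U)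
    (hz : z ∈ U) (v : E) :
    dirDeriv v (dirDeriv v fun x => f x + g x) z =
      dirDeriv v (dirDeriv v f) z + dirDeriv v (dirDeriv v g) z := by
  have hadd : EqOn (dirDeriv v fun x => f x + g x)
      (fun x => dirDeriv v f x + dirDeriv v g x) U := fun x hx =>
    dirDeriv_add (differentiableAt_of_contDiffOn hf hU two_ne_zero hx)
      (differentiableAt_of_contDiffOn hg hU two_ne_zero hx) v
  rw [dirDeriv_congr hU hadd v hz]
  exact dirDeriv_add
    (differentiableAt_of_contDiffOn (contDiffOn_dirDeriv hf hU one_add_one_eq_two.le v) hU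
      one_ne_zero hz)
    (differentiableAt_of_contDiffOn (contDiffOn_dirDeriv hg hU one_add_one_eq_two.le v) hU
      one_ne_zero hz) v

lemma dirDeriv_dirDeriv_comm (hU : IsOpen U) (hf : ContDiffOn ℝ 2 f U) (hz : z ∈ U) (v w : E) :
    dirDeriv v (dirDeriv w f) z = dirDeriv w (dirDeriv v f) z := by
  have hat : ContDiffAt ℝ 2 f z := hf.contDiffAt (hU.mem_nhds hz)
  have hd : DifferentiableAt ℝ (fderiv ℝ f) z :=
    (hat.fderiv_right (m := 1) one_add_one_eq_two.le).differentiableAt one_ne_zero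
  have hsnd : ∀ v w : E, dirDeriv v (dirDeriv w f) z = fderiv ℝ (fderiv ℝ f) z v w := fun v w => by
    have : HasFDerivAt (fun x => fderiv ℝ f x w) _ z :=
      hd.hasFDerivAt.clm_apply (hasFDerivAt_const w z)
    unfold dirDeriv
    simp [this.fderiv]
  rw [hsnd, hsnd]
  exact hat.isSymmSndFDerivAt (by simp) v w

lemma hasDerivAt_line {v : E} {t : ℝ} (hf : DifferentiableAt ℝ f (z + t • v)) :
    HasDerivAt (fun s : ℝ => f (z + s • v)) (dirDeriv v f (z + t • v)) t := by
  have h : HasDerivAt (fun s : ℝ => z + s • v) v t := by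
    simpa using ((hasDerivAt_id t).smul_const v).const_add z
  exact hf.hasFDerivAt.comp_hasDerivAt t h

lemma dirDeriv_eq_zero_of_notMem_tsupport (hz : z ∉ tsupport f) (v : E) : dirDeriv v f z = 0 := by
  simp [dirDeriv, (notMem_tsupport_iff_eventuallyEq.1 hz).fderiv_eq]

lemma tsupport_dirDeriv_subset (f : E → ℝ) (v : E) : tsupport (dirDeriv v f) ⊆ tsupport f :=
  closure_minimal
    (fun _ hz => by_contra fun hn => hz (dirDeriv_eq_zero_of_notMem_tsupport hn v))
    (isClosed_tsupport f)

lemma deriv_deriv_nonpos_of_isLocalMax {f : ℝ → ℝ} {x : ℝ} (hmax : IsLocalMax f x)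
    (hc : ContinuousAt f x) : deriv (deriv f) x ≤ 0 := by
  by_contra! hpos
  have hmin : IsLocalMin f x := isLocalMin_of_deriv_deriv_pos hpos hmax.deriv_eq_zero hc
  have hconst : f =ᶠ[𝓝 x] fun _ => f x := by
    filter_upwards [hmax, hmin] with s h1 h2 using le_antisymm h1 h2
  have hderiv : deriv f =ᶠ[𝓝 x] fun _ => 0 := by simpa using hconst.deriv
  simp [hderiv.deriv_eq] at hpos

lemma dirDeriv_dirDeriv_nonpos_of_isLocalMax (hU : IsOpen U) (hf : ContDiffOn ℝ 2 f U)
    (hz : z ∈ U) (hmax : IsLocalMax f z) (v : E) : dirDeriv v (dirDeriv v f) z ≤ 0 := by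
  have hline : Continuous fun s : ℝ => z + s • v := by fun_prop
  have hzero : z + (0 : ℝ) • v = z := by simp
  have hmem : ∀ᶠ s in 𝓝 (0 : ℝ), z + s • v ∈ U :=
    hline.continuousAt.eventually_mem (by simpa using hU.mem_nhds hz)
  have hd1 : ∀ s : ℝ, z + s • v ∈ U →
      HasDerivAt (fun s : ℝ => f (z + s • v)) (dirDeriv v f (z + s • v)) s := fun s hs =>
    hasDerivAt_line (differentiableAt_of_contDiffOn hf hU two_ne_zero hs)
  have hd2 :
      HasDerivAt (fun s : ℝ => dirDeriv v f (z + s • v)) (dirDeriv v (dirDeriv v f) z) 0 := by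
    have := hasDerivAt_line (f := dirDeriv v f) (z := z) (v := v) (t := 0)
      (differentiableAt_of_contDiffOn (contDiffOn_dirDeriv hf hU one_add_one_eq_two.le v) hU
        one_ne_zero (by rwa [hzero]))
    rwa [hzero] at this
  have hderiv : deriv (fun s : ℝ => f (z + s • v)) =ᶠ[𝓝 0] fun s => dirDeriv v f (z + s • v) := by
    filter_upwards [hmem] with s hs using (hd1 s hs).deriv
  have hlinemax : IsLocalMax (fun s : ℝ => f (z + s • v)) 0 :=
    IsLocalMax.comp_continuous (g := fun s : ℝ => z + s • v) (b := 0) (by rwa [hzero])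
      hline.continuousAt
  have := deriv_deriv_nonpos_of_isLocalMax hlinemax (hd1 0 (by rwa [hzero])).continuousAt
  rwa [hderiv.deriv_eq, hd2.deriv] at this

lemma le_of_hasDerivAt_of_le {g : ℝ → ℝ} {g' C : ℝ} (hg : HasDerivAt g g' 0) (h0 : g 0 = 0)
    (hle : ∀ t ∈ Ioc (0 : ℝ) 1, g t ≤ C * t) : g' ≤ C := by
  refine le_of_tendsto hg.tendsto_slope_zero_right ?_
  filter_upwards [Ioc_mem_nhdsGT (zero_lt_one' ℝ)] with t ht
  simpa only [zero_add, h0, sub_zero, smul_eq_mul, inv_mul_le_iff₀ ht.1, mul_comm t] using hle t ht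

end DirectionalDerivative

section Laplacian

variable {f g w : ℝ × ℝ → ℝ} {U : Set (ℝ × ℝ)} {z : ℝ × ℝ}

/-- The Laplacian `∂ₓ²f + ∂_y²f`. -/
def lap (f : ℝ × ℝ → ℝ) (z : ℝ × ℝ) : ℝ := dx (dx f) z + dy (dy f) z

/-- The squared Euclidean length `|∇f|²` of the gradient. -/
def gradSq (f : ℝ × ℝ → ℝ) (z : ℝ × ℝ) : ℝ := dx f z ^ 2 + dy f z ^ 2

lemma dx_eq_dirDeriv (f : ℝ × ℝ → ℝ) : dx f = dirDeriv (1, 0) f := rfl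

lemma dy_eq_dirDeriv (f : ℝ × ℝ → ℝ) : dy f = dirDeriv (0, 1) f := rfl

lemma lap_eq_dirDeriv (f : ℝ × ℝ → ℝ) (z : ℝ × ℝ) :
    lap f z = dirDeriv (1, 0) (dirDeriv (1, 0) f) z + dirDeriv (0, 1) (dirDeriv (0, 1) f) z := rfl

lemma lap_congr (hU : IsOpen U) (h : EqOn f g U) : EqOn (lap f) (lap g) U := fun z hz => by
  simp only [lap_eq_dirDeriv, dirDeriv_congr hU (dirDeriv_congr hU h _) _ hz]

lemma lap_add (hU : IsOpen U) (hf : ContDiffOn ℝ 2 f U) (hg : ContDiffOn ℝ 2 g U) (hz : z ∈ U) :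
    lap (fun x => f x + g x) z = lap f z + lap g z := by
  simp only [lap_eq_dirDeriv, dirDeriv_dirDeriv_add hU hf hg hz]
  ring

lemma lap_const_mul (c : ℝ) (f : ℝ × ℝ → ℝ) (z : ℝ × ℝ) :
    lap (fun x => c * f x) z = c * lap f z := by
  simp only [lap_eq_dirDeriv, dirDeriv_const_mul]
  ring

lemma lap_neg (f : ℝ × ℝ → ℝ) (z : ℝ × ℝ) : lap (fun x => -f x) z = -lap f z := by
  simpa using lap_const_mul (-1) f z

lemma lap_sub (hU : IsOpen U) (hf : ContDiffOn ℝ 2 f U) (hg : ContDiffOn ℝ 2 g U) (hz : z ∈ U) :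
    lap (fun x => f x - g x) z = lap f z - lap g z := by
  simp only [sub_eq_add_neg]
  rw [lap_add hU hf hg.neg hz, lap_neg]

lemma lap_comp_add_right (f : ℝ × ℝ → ℝ) (a z : ℝ × ℝ) :
    lap (fun x => f (x + a)) z = lap f (z + a) := by
  simp only [lap_eq_dirDeriv, dirDeriv_comp_add_right]

lemma continuous_lap (hf : ContDiff ℝ 2 f) : Continuous (lap f) := by
  have hsnd : ∀ v, Continuous (dirDeriv v (dirDeriv v f)) := fun v =>
    (contDiff_dirDeriv (m := 0) (contDiff_dirDeriv (m := 1) hf one_add_one_eq_two.le v)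
      (zero_add 1).le v).continuous
  exact (hsnd (1, 0)).add (hsnd (0, 1))

lemma lap_eq_zero_of_notMem_tsupport (hz : z ∉ tsupport f) : lap f z = 0 := by
  have hsnd : ∀ v, dirDeriv v (dirDeriv v f) z = 0 := fun v =>
    dirDeriv_eq_zero_of_notMem_tsupport (fun h => hz (tsupport_dirDeriv_subset f v h)) v
  rw [lap_eq_dirDeriv, hsnd, hsnd, add_zero]

lemma tsupport_lap_subset (f : ℝ × ℝ → ℝ) : tsupport (lap f) ⊆ tsupport f :=
  closure_minimal (fun z hz => by
    by_contra hzf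
    exact hz (lap_eq_zero_of_notMem_tsupport hzf)) (isClosed_tsupport f)

/-- The reflection `(x, y) ↦ (-x, y)` of the plane. -/
def reflection : (ℝ × ℝ) ≃L[ℝ] (ℝ × ℝ) :=
  (ContinuousLinearEquiv.neg ℝ).prodCongr (ContinuousLinearEquiv.refl ℝ ℝ)

lemma reflection_apply (z : ℝ × ℝ) : reflection z = (-z.1, z.2) := rfl

lemma dx_comp_reflection (f : ℝ × ℝ → ℝ) :
    dx (fun x => f (reflection x)) = fun x => -dx f (reflection x) := by
  have h : reflection (1, 0) = -(1, 0) := by simp [reflection_apply]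
  simp only [dx_eq_dirDeriv, dirDeriv_comp_linearEquiv, h, dirDeriv_neg_left]

lemma dy_comp_reflection (f : ℝ × ℝ → ℝ) :
    dy (fun x => f (reflection x)) = fun x => dy f (reflection x) := by
  have h : reflection (0, 1) = (0, 1) := by simp [reflection_apply]
  simp only [dy_eq_dirDeriv, dirDeriv_comp_linearEquiv, h]

lemma lap_comp_reflection (f : ℝ × ℝ → ℝ) (z : ℝ × ℝ) :
    lap (fun x => f (reflection x)) z = lap f (reflection z) := by
  have hneg : dx (fun x => -dx f (reflection x)) = fun x => -dx (fun x => dx f (reflection x)) x :=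
    dirDeriv_neg _ _
  simp only [lap, dx_comp_reflection, hneg, dy_comp_reflection, neg_neg]

lemma dx_mul_fst_snd {p q : ℝ → ℝ} (hp : Differentiable ℝ p) (hq : Differentiable ℝ q) :
    dx (fun z => p z.1 * q z.2) = fun z => deriv p z.1 * q z.2 := by
  funext z
  have h := ((hp z.1).hasDerivAt.comp_hasFDerivAt z
    (ContinuousLinearMap.fst ℝ ℝ ℝ).hasFDerivAt).fun_mul
    ((hq z.2).hasDerivAt.comp_hasFDerivAt z (ContinuousLinearMap.snd ℝ ℝ ℝ).hasFDerivAt)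
  simp only [Function.comp_def] at h
  simp [dx, h.fderiv, mul_comm]

lemma dy_mul_fst_snd {p q : ℝ → ℝ} (hp : Differentiable ℝ p) (hq : Differentiable ℝ q) :
    dy (fun z => p z.1 * q z.2) = fun z => p z.1 * deriv q z.2 := by
  funext z
  have h := ((hp z.1).hasDerivAt.comp_hasFDerivAt z
    (ContinuousLinearMap.fst ℝ ℝ ℝ).hasFDerivAt).fun_mul
    ((hq z.2).hasDerivAt.comp_hasFDerivAt z (ContinuousLinearMap.snd ℝ ℝ ℝ).hasFDerivAt)
  simp only [Function.comp_def] at h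
  simp [dy, h.fderiv]

lemma lap_mul_fst_snd {p q : ℝ → ℝ} (hp : ContDiff ℝ 2 p) (hq : ContDiff ℝ 2 q) (z : ℝ × ℝ) :
    lap (fun z => p z.1 * q z.2) z =
      deriv (deriv p) z.1 * q z.2 + p z.1 * deriv (deriv q) z.2 := by
  have hd : ∀ {r : ℝ → ℝ}, ContDiff ℝ 2 r → Differentiable ℝ r ∧ Differentiable ℝ (deriv r) :=
    fun hr => ⟨hr.differentiable two_ne_zero,
      ContDiff.differentiable (n := 1) (by simpa using hr.iterate_deriv' 1 1) one_ne_zero⟩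
  rw [lap, dx_mul_fst_snd (hd hp).1 (hd hq).1, dy_mul_fst_snd (hd hp).1 (hd hq).1,
    dx_mul_fst_snd (hd hp).2 (hd hq).1, dy_mul_fst_snd (hd hp).1 (hd hq).2]

lemma lap_add_fst_snd {p q : ℝ → ℝ} (hp : ContDiff ℝ 2 p) (hq : ContDiff ℝ 2 q) (z : ℝ × ℝ) :
    lap (fun z => p z.1 + q z.2) z = deriv (deriv p) z.1 + deriv (deriv q) z.2 := by
  have hp' := lap_mul_fst_snd hp (contDiff_const (c := (1 : ℝ))) z
  have hq' := lap_mul_fst_snd (contDiff_const (c := (1 : ℝ))) hq z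
  simp only [mul_one, one_mul, deriv_const', mul_zero, zero_mul, add_zero, zero_add] at hp' hq'
  rw [lap_add isOpen_univ (by fun_prop) (by fun_prop) (mem_univ z), hp', hq']

/-- The quadratic polynomials `a + b x + p x² + q y²`, used as barriers. -/
def quad (a b p q : ℝ) (z : ℝ × ℝ) : ℝ := a + b * z.1 + p * z.1 ^ 2 + q * z.2 ^ 2

lemma contDiff_quad (a b p q : ℝ) : ContDiff ℝ 2 (quad a b p q) := by
  unfold quad
  fun_prop

lemma deriv_deriv_quadratic (a b p t : ℝ) :
    deriv (deriv fun x : ℝ => a + b * x + p * x ^ 2) t = 2 * p := by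
  have h1 : deriv (fun x : ℝ => a + b * x + p * x ^ 2) = fun x => b + 2 * p * x := by
    funext x
    have := (((hasDerivAt_id x).const_mul b).const_add a).add ((hasDerivAt_pow 2 x).const_mul p)
    exact this.deriv.trans (by simp; ring)
  have h2 : HasDerivAt (fun x : ℝ => b + 2 * p * x) (2 * p * 1) t :=
    ((hasDerivAt_id t).const_mul _).const_add b
  rw [h1, h2.deriv, mul_one]

lemma lap_quad (a b p q : ℝ) (z : ℝ × ℝ) : lap (quad a b p q) z = 2 * p + 2 * q := by
  have hsplit : quad a b p q =
      fun z => (a + b * z.1 + p * z.1 ^ 2) + (0 + 0 * z.2 + q * z.2 ^ 2) := by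
    funext z
    simp only [quad]
    ring
  have hlap := lap_add_fst_snd (p := fun x => a + b * x + p * x ^ 2)
    (q := fun y => 0 + 0 * y + q * y ^ 2) (by fun_prop) (by fun_prop) z
  rwa [deriv_deriv_quadratic, deriv_deriv_quadratic, ← hsplit] at hlap

lemma nonpos_of_lap_nonneg (hU : IsOpen U) (hK : IsCompact (closure U))
    (hc : ContinuousOn w (closure U)) (hw : ContDiffOn ℝ 2 w U) (hlap : ∀ z ∈ U, 0 ≤ lap w z)
    (hfr : ∀ z ∈ frontier U, w z ≤ 0) (hz : z ∈ closure U) : w z ≤ 0 := by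
  by_contra! hpos
  obtain ⟨B, hB⟩ := hK.exists_bound_of_continuousOn (f := fun x : ℝ × ℝ => x.2 ^ 2) (by fun_prop)
  have hsq : ∀ x ∈ closure U, x.2 ^ 2 ≤ B := fun x hx => (Real.le_norm_self _).trans (hB x hx)
  have hB0 : 0 ≤ B := (sq_nonneg z.2).trans (hsq z hz)
  set δ := w z / (B + 1)
  have hδ : 0 < δ := by positivity
  have hwz : w z = δ * (B + 1) := by simp only [δ]; field_simp
  have hbarrier : ContDiff ℝ 2 (quad (-(δ * B)) 0 0 δ) := contDiff_quad _ _ _ _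
  -- adding `δ (y² - B) ≤ 0` makes the Laplacian positive, which excludes an interior maximum
  obtain ⟨m, hmK, hm⟩ := hK.exists_isMaxOn ⟨z, hz⟩ (hc.add hbarrier.continuous.continuousOn)
  have hmpos : 0 < w m + quad (-(δ * B)) 0 0 δ m := by
    have hle : w z + quad (-(δ * B)) 0 0 δ z ≤ w m + quad (-(δ * B)) 0 0 δ m := hm hz
    have : quad (-(δ * B)) 0 0 δ z = δ * z.2 ^ 2 - δ * B := by simp only [quad]; ring
    nlinarith [mul_nonneg hδ.le (sq_nonneg z.2)]
  have hmU : m ∈ U := by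
    by_contra hnot
    have hwm := hfr m (hU.frontier_eq ▸ ⟨hmK, hnot⟩)
    simp only [quad] at hmpos
    nlinarith [mul_nonneg hδ.le (sub_nonneg.2 (hsq m hmK))]
  have hloc : IsLocalMax (fun x => w x + quad (-(δ * B)) 0 0 δ x) m := by
    filter_upwards [hU.mem_nhds hmU] with x hx using hm (subset_closure hx)
  have hsnd := fun v => dirDeriv_dirDeriv_nonpos_of_isLocalMax hU (hw.add hbarrier.contDiffOn) hmU
    hloc v
  have hlapm := lap_add hU hw hbarrier.contDiffOn hmU
  rw [lap_quad, lap_eq_dirDeriv] at hlapm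
  linarith [hlap m hmU, hsnd (1, 0), hsnd (0, 1)]

lemma nonpos_of_lap_nonneg_of_rectangle {a b c d : ℝ} (hab : a < b) (hcd : c < d)
    (hc : ContinuousOn w (Icc a b ×ˢ Icc c d)) (hw : ContDiffOn ℝ 2 w (Ioo a b ×ˢ Ioo c d))
    (hlap : ∀ z ∈ Ioo a b ×ˢ Ioo c d, 0 ≤ lap w z)
    (hleft : ∀ y ∈ Icc c d, w (a, y) ≤ 0) (hright : ∀ y ∈ Icc c d, w (b, y) ≤ 0)
    (hbottom : ∀ x ∈ Icc a b, w (x, c) ≤ 0) (htop : ∀ x ∈ Icc a b, w (x, d) ≤ 0)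
    (hz : z ∈ Icc a b ×ˢ Icc c d) : w z ≤ 0 := by
  have hcl : closure (Ioo a b ×ˢ Ioo c d) = Icc a b ×ˢ Icc c d := by
    rw [closure_prod_eq, closure_Ioo hab.ne, closure_Ioo hcd.ne]
  rw [← hcl] at hc hz
  refine nonpos_of_lap_nonneg (isOpen_Ioo.prod isOpen_Ioo)
    (hcl ▸ isCompact_Icc.prod isCompact_Icc) hc hw hlap ?_ hz
  rw [frontier_prod_eq, closure_Ioo hab.ne, closure_Ioo hcd.ne, frontier_Ioo hab, frontier_Ioo hcd]
  rintro ⟨x, y⟩ (⟨hx, rfl | rfl⟩ | ⟨rfl | rfl, hy⟩)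
  exacts [hbottom x hx, htop x hx, hleft y hy, hright y hy]

end Laplacian

section Channel

variable {z : ℝ × ℝ}

lemma isOpen_openChannel : IsOpen openChannel := isOpen_univ.prod isOpen_Ioo

lemma openChannel_subset_channel : openChannel ⊆ channel :=
  prod_mono_right Ioo_subset_Icc_self

lemma mem_openChannel : z ∈ openChannel ↔ -1 < z.2 ∧ z.2 < 1 := by simp [openChannel]

lemma mem_channel : z ∈ channel ↔ -1 ≤ z.2 ∧ z.2 ≤ 1 := by simp [channel]

lemma sq_snd_le_one (hz : z ∈ channel) : z.2 ^ 2 ≤ 1 :=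
  sq_le_one_iff_abs_le_one _ |>.2 (abs_le.2 (mem_channel.1 hz))

lemma add_mem_channel (h : ℝ) (hz : z ∈ channel) : z + (h, 0) ∈ channel := by
  simpa [mem_channel] using hz

lemma add_mem_openChannel (h : ℝ) (hz : z ∈ openChannel) : z + (h, 0) ∈ openChannel := by
  simpa [mem_openChannel] using hz

lemma reflection_mem_channel (hz : z ∈ channel) : reflection z ∈ channel := by
  simpa [mem_channel, reflection_apply] using hz

lemma reflection_mem_openChannel (hz : z ∈ openChannel) : reflection z ∈ openChannel := by
  simpa [mem_openChannel, reflection_apply] using hz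

variable {f : ℝ × ℝ → ℝ}

lemma hasDerivAt_horizontal (hf : ContDiffOn ℝ 1 f openChannel) (hz : z ∈ openChannel) (t : ℝ) :
    HasDerivAt (fun s : ℝ => f (z + (s, 0))) (dx f (z + (t, 0))) t := by
  have := hasDerivAt_line (f := f) (z := z) (v := (1, 0)) (t := t)
    (differentiableAt_of_contDiffOn hf isOpen_openChannel one_ne_zero
      (by simpa using add_mem_openChannel t hz))
  simpa [dx_eq_dirDeriv] using this

lemma abs_horizontal_sub_le {C h : ℝ} (hf : ContDiffOn ℝ 1 f openChannel) (hz : z ∈ openChannel)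
    (hh : 0 ≤ h) (hC : ∀ s ∈ Icc 0 h, |dx f (z + (s, 0))| ≤ C) :
    |f (z + (h, 0)) - f z| ≤ C * h := by
  have := norm_image_sub_le_of_norm_deriv_le_segment' (f := fun s : ℝ => f (z + (s, 0)))
    (fun s _ => (hasDerivAt_horizontal hf hz s).hasDerivWithinAt)
    (fun s hs => hC s (Ico_subset_Icc_self hs)) h ⟨hh, le_rfl⟩
  simpa only [Prod.mk_zero_zero, add_zero, sub_zero, Real.norm_eq_abs] using this

end Channel

namespace IsStreamFunction

variable {f g u v : ℝ × ℝ → ℝ} {z : ℝ × ℝ} {N : ℝ}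

lemma lap_eq (hu : IsStreamFunction f u) (hz : z ∈ openChannel) : lap u z = -f z := by
  rw [← hu.poisson z hz, neg_neg, lap]

lemma const_mul (hu : IsStreamFunction f u) (c : ℝ) :
    IsStreamFunction (fun z => c * f z) (fun z => c * u z) where
  contDiffOn := contDiffOn_const.mul hu.contDiffOn
  continuousOn := hu.continuousOn.const_mul c
  bounded := by
    obtain ⟨M, hM⟩ := hu.bounded
    refine ⟨|c| * M, fun z hz => ?_⟩
    rw [abs_mul]
    exact mul_le_mul_of_nonneg_left (hM z hz) (abs_nonneg c)
  bottom x := by rw [hu.bottom, mul_zero]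
  top x := by rw [hu.top, mul_zero]
  poisson z hz := by
    change -lap (fun z => c * u z) z = c * f z
    rw [lap_const_mul, hu.lap_eq hz, mul_neg, neg_neg]

lemma neg (hu : IsStreamFunction f u) : IsStreamFunction (fun z => -f z) (fun z => -u z) := by
  simpa using hu.const_mul (-1)

lemma sub (hu : IsStreamFunction f u) (hv : IsStreamFunction g v) :
    IsStreamFunction (fun z => f z - g z) (fun z => u z - v z) where
  contDiffOn := hu.contDiffOn.sub hv.contDiffOn
  continuousOn := hu.continuousOn.sub hv.continuousOn
  bounded := by
    obtain ⟨M, hM⟩ := hu.bounded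
    obtain ⟨M', hM'⟩ := hv.bounded
    exact ⟨M + M', fun z hz => (abs_sub _ _).trans (add_le_add (hM z hz) (hM' z hz))⟩
  bottom x := by rw [hu.bottom, hv.bottom, sub_zero]
  top x := by rw [hu.top, hv.top, sub_zero]
  poisson z hz := by
    change -lap (fun z => u z - v z) z = f z - g z
    rw [lap_sub isOpen_openChannel hu.contDiffOn hv.contDiffOn hz, hu.lap_eq hz, hv.lap_eq hz]
    ring

lemma translate (hu : IsStreamFunction f u) (h : ℝ) :
    IsStreamFunction (fun z => f (z + (h, 0))) (fun z => u (z + (h, 0))) where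
  contDiffOn := hu.contDiffOn.comp (contDiff_id.add contDiff_const).contDiffOn
    fun _ hz => add_mem_openChannel h hz
  continuousOn := hu.continuousOn.comp (by fun_prop) fun _ hz => add_mem_channel h hz
  bounded := hu.bounded.imp fun _ hM z hz => hM _ (add_mem_channel h hz)
  bottom x := by simp [hu.bottom]
  top x := by simp [hu.top]
  poisson z hz := by
    change -lap (fun z => u (z + (h, 0))) z = f (z + (h, 0))
    rw [lap_comp_add_right, hu.lap_eq (add_mem_openChannel h hz), neg_neg]

lemma reflect (hu : IsStreamFunction f u) :
    IsStreamFunction (fun z => f (reflection z)) (fun z => u (reflection z)) where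
  contDiffOn := hu.contDiffOn.comp reflection.contDiff.contDiffOn
    fun _ hz => reflection_mem_openChannel hz
  continuousOn := hu.continuousOn.comp reflection.continuous.continuousOn
    fun _ hz => reflection_mem_channel hz
  bounded := hu.bounded.imp fun _ hM z hz => hM _ (reflection_mem_channel hz)
  bottom x := by simp [reflection_apply, hu.bottom]
  top x := by simp [reflection_apply, hu.top]
  poisson z hz := by
    change -lap (fun z => u (reflection z)) z = f (reflection z)
    rw [lap_comp_reflection, hu.lap_eq (reflection_mem_openChannel hz), neg_neg]

lemma contDiffOn_dx (hu : IsStreamFunction f u) : ContDiffOn ℝ 1 (dx u) openChannel :=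
  contDiffOn_dirDeriv hu.contDiffOn isOpen_openChannel one_add_one_eq_two.le (1, 0)

lemma contDiffOn_dy (hu : IsStreamFunction f u) : ContDiffOn ℝ 1 (dy u) openChannel :=
  contDiffOn_dirDeriv hu.contDiffOn isOpen_openChannel one_add_one_eq_two.le (0, 1)

lemma contDiffOn_one (hu : IsStreamFunction f u) : ContDiffOn ℝ 1 u openChannel :=
  hu.contDiffOn.of_le one_le_two

lemma differentiableAt (hu : IsStreamFunction f u) (hz : z ∈ openChannel) :
    DifferentiableAt ℝ u z :=
  differentiableAt_of_contDiffOn hu.contDiffOn isOpen_openChannel two_ne_zero hz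

lemma le_add_of_pos (hu : IsStreamFunction f u) (hN : ∀ z ∈ openChannel, f z ≤ N)
    (hz : z ∈ channel) {δ : ℝ} (hδ : 0 < δ) :
    u z ≤ N * (1 - z.2 ^ 2) / 2 + δ * (z.1 ^ 2 + 1 - z.2 ^ 2) := by
  obtain ⟨M, hM⟩ := hu.bounded
  -- on a rectangle this long the term `δ x²` dominates the bounded remainder at the vertical sides
  obtain ⟨R, hzR, hR, hMR⟩ := ((eventually_ge_atTop |z.1|).and ((eventually_gt_atTop 0).and
    (((tendsto_pow_atTop two_ne_zero).const_mul_atTop hδ).eventually_ge_atTop (M + |N|)))).exists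
  set q := quad (-N / 2 - δ) 0 (-δ) (N / 2 + δ)
  have hq : ContDiff ℝ 2 q := contDiff_quad _ _ _ _
  have hopen : Ioo (-R) R ×ˢ Ioo (-1 : ℝ) 1 ⊆ openChannel := prod_mono_left (subset_univ _)
  have hclosed : Icc (-R) R ×ˢ Icc (-1 : ℝ) 1 ⊆ channel := prod_mono_left (subset_univ _)
  have hside : ∀ x y : ℝ, x ^ 2 = R ^ 2 → y ∈ Icc (-1 : ℝ) 1 → u (x, y) + q (x, y) ≤ 0 := by
    intro x y hx hy
    have hxy : (x, y) ∈ channel := mem_channel.2 hy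
    have hy2 : y ^ 2 ≤ 1 := sq_snd_le_one hxy
    have huM := (le_abs_self _).trans (hM _ hxy)
    have hNy : -N / 2 * (1 - y ^ 2) ≤ |N| := by
      nlinarith [neg_abs_le N, abs_nonneg N, mul_nonneg (abs_nonneg N) (sq_nonneg y),
        mul_nonneg (sub_nonneg.2 (neg_abs_le N)) (sub_nonneg.2 hy2)]
    simp only [q, quad, hx]
    nlinarith [mul_nonneg hδ.le (sub_nonneg.2 hy2)]
  have hwall : ∀ x y : ℝ, y ^ 2 = 1 → u (x, y) = 0 → u (x, y) + q (x, y) ≤ 0 := by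
    intro x y hy hu0
    simp only [q, quad, hy, hu0]
    nlinarith [mul_nonneg hδ.le (sq_nonneg x)]
  have hle := nonpos_of_lap_nonneg_of_rectangle (w := fun x => u x + q x)
    (by linarith : -R < R) (by norm_num : (-1 : ℝ) < 1)
    ((hu.continuousOn.mono hclosed).add hq.continuous.continuousOn)
    ((hu.contDiffOn.mono hopen).add hq.contDiffOn)
    (fun x hx => by
      rw [lap_add isOpen_openChannel hu.contDiffOn hq.contDiffOn (hopen hx), lap_quad,
        hu.lap_eq (hopen hx)]
      linarith [hN x (hopen hx)])
    (fun y hy => hside _ y (neg_sq R) hy) (fun y hy => hside _ y rfl hy)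
    (fun x _ => hwall x _ (by norm_num) (hu.bottom x))
    (fun x _ => hwall x _ (by norm_num) (hu.top x))
    (z := z) ⟨abs_le.1 hzR, mem_channel.1 hz⟩
  simp only [q, quad] at hle
  linarith

lemma le_of_le (hu : IsStreamFunction f u) (hN : ∀ z ∈ openChannel, f z ≤ N) (hz : z ∈ channel) :
    u z ≤ N * (1 - z.2 ^ 2) / 2 := by
  have hlim : Tendsto (fun δ : ℝ => N * (1 - z.2 ^ 2) / 2 + δ * (z.1 ^ 2 + 1 - z.2 ^ 2))
      (𝓝[>] 0) (𝓝 (N * (1 - z.2 ^ 2) / 2 + 0 * (z.1 ^ 2 + 1 - z.2 ^ 2))) :=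
    (Continuous.tendsto (by fun_prop) 0).mono_left nhdsWithin_le_nhds
  rw [zero_mul, add_zero] at hlim
  exact ge_of_tendsto hlim (eventually_mem_nhdsWithin.mono fun _ hδ => hu.le_add_of_pos hN hz hδ)

lemma abs_le_of_abs_le (hu : IsStreamFunction f u) (hN : ∀ z ∈ openChannel, |f z| ≤ N)
    (hz : z ∈ channel) : |u z| ≤ N * (1 - z.2 ^ 2) / 2 :=
  abs_le'.2 ⟨hu.le_of_le (fun z hz => (le_abs_self _).trans (hN z hz)) hz,
    hu.neg.le_of_le (fun z hz => (neg_le_abs _).trans (hN z hz)) hz⟩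

lemma le_of_eq_zero_on_axis (hu : IsStreamFunction f u) (hN : ∀ z ∈ openChannel, |f z| ≤ N)
    (haxis : ∀ y : ℝ, u (0, y) = 0) (hz : z ∈ Icc 0 1 ×ˢ Icc (-1) 1) :
    u z ≤ N * (z.1 - z.1 ^ 2 / 2) := by
  have hN0 : 0 ≤ N := (abs_nonneg _).trans (hN 0 (by simp [mem_openChannel]))
  set q := quad 0 (-N) (N / 2) 0
  have hq : ContDiff ℝ 2 q := contDiff_quad _ _ _ _
  have hopen : Ioo 0 1 ×ˢ Ioo (-1 : ℝ) 1 ⊆ openChannel := prod_mono_left (subset_univ _)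
  have hclosed : Icc 0 1 ×ˢ Icc (-1 : ℝ) 1 ⊆ channel := prod_mono_left (subset_univ _)
  have hqnonpos : ∀ x ∈ Icc (0 : ℝ) 1, ∀ y, q (x, y) ≤ 0 := by
    intro x hx y
    simp only [q, quad]
    nlinarith [mul_nonneg hN0 hx.1, hx.2]
  have hle := nonpos_of_lap_nonneg_of_rectangle (w := fun x => u x + q x) zero_lt_one
    (by norm_num : (-1 : ℝ) < 1) ((hu.continuousOn.mono hclosed).add hq.continuous.continuousOn)
    ((hu.contDiffOn.mono hopen).add hq.contDiffOn)
    (fun x hx => by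
      rw [lap_add isOpen_openChannel hu.contDiffOn hq.contDiffOn (hopen hx), lap_quad,
        hu.lap_eq (hopen hx)]
      linarith [(le_abs_self _).trans (hN x (hopen hx))])
    (fun y _ => by simp [q, quad, haxis])
    (fun y hy => by
      have := (le_abs_self _).trans (hu.abs_le_of_abs_le hN (z := (1, y)) (mem_channel.2 hy))
      simp only [q, quad]
      nlinarith [mul_nonneg hN0 (sq_nonneg y)])
    (fun x hx => by simpa [hu.bottom] using hqnonpos x hx _)
    (fun x hx => by simpa [hu.top] using hqnonpos x hx _) hz
  simp only [q, quad] at hle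
  linarith

/-- Twice `∂ₓu` at `z` is the derivative on the axis of the odd part of `u` about the vertical line
through `z`, which vanishes on that line. -/
lemma dx_le_of_abs_le (hu : IsStreamFunction f u) (hN : ∀ z ∈ openChannel, |f z| ≤ N)
    (hz : z ∈ openChannel) : dx u z ≤ N := by
  obtain ⟨x₀, y₀⟩ := z
  have hy₀ : ((0 : ℝ), y₀) ∈ openChannel := mem_openChannel.2 (mem_openChannel.1 hz)
  have hright := hu.translate x₀
  have hodd := hright.sub hright.reflect
  have hrhs : ∀ z ∈ openChannel,
      |f (z + (x₀, 0)) - f (reflection z + (x₀, 0))| ≤ 2 * N := fun z hz => by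
    have hpair := add_le_add (hN _ (add_mem_openChannel x₀ hz))
      (hN _ (add_mem_openChannel x₀ (reflection_mem_openChannel hz)))
    linarith [abs_sub (f (z + (x₀, 0))) (f (reflection z + (x₀, 0)))]
  have hN0 : 0 ≤ 2 * N := (abs_nonneg _).trans (hrhs _ hy₀)
  have hline := hasDerivAt_horizontal hodd.contDiffOn_one hy₀ 0
  have hle := le_of_hasDerivAt_of_le (C := 2 * N) hline (by simp [reflection_apply]) fun t ht => by
    have hmem : ((0 : ℝ), y₀) + (t, 0) ∈ Icc (0 : ℝ) 1 ×ˢ Icc (-1 : ℝ) 1 :=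
      ⟨by simpa using ⟨ht.1.le, ht.2⟩, by simpa using mem_channel.1 (openChannel_subset_channel hz)⟩
    refine (hodd.le_of_eq_zero_on_axis hrhs (by simp [reflection_apply]) hmem).trans ?_
    simp only [Prod.fst_add, zero_add]
    nlinarith [mul_nonneg hN0 (sq_nonneg t)]
  have hdx : dx (fun z => u (z + (x₀, 0)) - u (reflection z + (x₀, 0))) (0, y₀) =
      2 * dx u (x₀, y₀) := by
    have htranslate : dx (fun z => u (z + (x₀, 0))) = fun z => dx u (z + (x₀, 0)) :=
      dirDeriv_comp_add_right u _ _
    have hreflect := dx_comp_reflection fun z => u (z + (x₀, 0))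
    rw [dx_eq_dirDeriv, dirDeriv_sub (hright.differentiableAt hy₀)
      (hright.reflect.differentiableAt hy₀), ← dx_eq_dirDeriv, ← dx_eq_dirDeriv, hreflect,
      htranslate]
    simp only [reflection_apply, neg_zero, Prod.mk_add_mk, zero_add, add_zero]
    ring
  rw [Prod.mk_zero_zero, add_zero, hdx] at hle
  linarith

lemma abs_dx_le_of_abs_le (hu : IsStreamFunction f u) (hN : ∀ z ∈ openChannel, |f z| ≤ N)
    (hz : z ∈ openChannel) : |dx u z| ≤ N := by
  refine abs_le'.2 ⟨hu.dx_le_of_abs_le hN hz, ?_⟩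
  have := hu.neg.dx_le_of_abs_le (fun z hz => by rw [abs_neg]; exact hN z hz) hz
  rwa [dx_eq_dirDeriv, dirDeriv_neg] at this

end IsStreamFunction

/-- The horizontal difference quotient `(f(x + h, y) - f(x, y)) / h`. -/
def diffQuot (h : ℝ) (f : ℝ × ℝ → ℝ) (z : ℝ × ℝ) : ℝ := h⁻¹ * (f (z + (h, 0)) - f z)

section DifferenceQuotient

variable {f ω ψ : ℝ × ℝ → ℝ} {z : ℝ × ℝ} {ε h : ℝ}

lemma tendsto_diffQuot (hf : ContDiffOn ℝ 1 f openChannel) (hz : z ∈ openChannel) :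
    Tendsto (fun h => diffQuot h f z) (𝓝[>] 0) (𝓝 (dx f z)) := by
  have := hasDerivAt_horizontal hf hz 0
  rw [Prod.mk_zero_zero, add_zero] at this
  simpa [diffQuot, Prod.mk_zero_zero] using this.tendsto_slope_zero_right

lemma abs_diffQuot_le {C : ℝ} (hf : ContDiffOn ℝ 1 f openChannel) (hz : z ∈ openChannel)
    (hh : 0 < h) (hC : ∀ s ∈ Icc 0 h, |dx f (z + (s, 0))| ≤ C) : |diffQuot h f z| ≤ C := by
  rw [diffQuot, abs_mul, abs_of_pos (inv_pos.2 hh), inv_mul_le_iff₀ hh, mul_comm]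
  exact abs_horizontal_sub_le hf hz hh.le hC

lemma exists_abs_diffQuot_le (hf : ContDiffOn ℝ 1 f openChannel) {K : Set (ℝ × ℝ)}
    (hK : IsCompact K) (hKU : K ⊆ openChannel) :
    ∃ C : ℝ, ∀ z ∈ K, ∀ h ∈ Ioc (0 : ℝ) 1, |diffQuot h f z| ≤ C := by
  have hthick : IsCompact ((fun p : (ℝ × ℝ) × ℝ => p.1 + (p.2, (0 : ℝ))) '' (K ×ˢ Icc 0 1)) :=
    (hK.prod isCompact_Icc).image (by fun_prop)
  obtain ⟨C, hC⟩ := hthick.exists_bound_of_continuousOn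
    ((continuousOn_dirDeriv hf isOpen_openChannel (1, 0)).mono (by
      rintro _ ⟨⟨z, s⟩, ⟨hz, -⟩, rfl⟩
      exact add_mem_openChannel s (hKU hz)))
  exact ⟨C, fun z hz h hh => abs_diffQuot_le hf (hKU hz) hh.1 fun s hs =>
    hC _ ⟨(z, s), ⟨hz, hs.1, hs.2.trans hh.2⟩, rfl⟩⟩

lemma dirDeriv_diffQuot (hf : ContDiffOn ℝ 1 f openChannel) (h : ℝ) (v : ℝ × ℝ)
    (hz : z ∈ openChannel) : dirDeriv v (diffQuot h f) z = diffQuot h (dirDeriv v f) z := by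
  have hd : ∀ z ∈ openChannel, DifferentiableAt ℝ f z := fun z hz =>
    differentiableAt_of_contDiffOn hf isOpen_openChannel one_ne_zero hz
  have htranslate : DifferentiableAt ℝ (fun x => f (x + (h, 0))) z :=
    (hd _ (add_mem_openChannel h hz)).comp z (by fun_prop)
  have hquot : diffQuot h f = fun x => h⁻¹ * (f (x + (h, 0)) - f x) := rfl
  rw [hquot, dirDeriv_const_mul]
  simp only [dirDeriv_sub htranslate (hd z hz), dirDeriv_comp_add_right, diffQuot]

lemma IsStreamFunction.diffQuot (hψ : IsStreamFunction ω ψ) (h : ℝ) :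
    IsStreamFunction (diffQuot h ω) (diffQuot h ψ) :=
  ((hψ.translate h).sub hψ).const_mul h⁻¹

variable (hψ : IsStreamFunction ω ψ) (hω : ContDiffOn ℝ 1 ω openChannel)
  (hdx : ∀ z ∈ openChannel, |dx ω z| ≤ ε)
include hψ hω hdx

lemma IsStreamFunction.abs_dx_le (hz : z ∈ openChannel) : |dx ψ z| ≤ ε / 2 * (1 - z.2 ^ 2) := by
  rw [div_mul_eq_mul_div]
  refine le_of_tendsto (tendsto_diffQuot hψ.contDiffOn_one hz).abs ?_
  filter_upwards [self_mem_nhdsWithin] with h hh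
  exact (hψ.diffQuot h).abs_le_of_abs_le
    (fun z hz => abs_diffQuot_le hω hz hh fun s _ => hdx _ (add_mem_openChannel s hz))
    (openChannel_subset_channel hz)

lemma IsStreamFunction.abs_dx_dx_le (hz : z ∈ openChannel) : |dx (dx ψ) z| ≤ ε := by
  refine le_of_tendsto (tendsto_diffQuot hψ.contDiffOn_dx hz).abs ?_
  filter_upwards [self_mem_nhdsWithin] with h hh
  rw [dx_eq_dirDeriv ψ, ← dirDeriv_diffQuot hψ.contDiffOn_one h _ hz]
  exact (hψ.diffQuot h).abs_dx_le_of_abs_le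
    (fun z hz => abs_diffQuot_le hω hz hh fun s _ => hdx _ (add_mem_openChannel s hz)) hz

lemma IsStreamFunction.abs_dy_dy_le (hsup : ∀ z ∈ openChannel, |ω z| ≤ ε) (hz : z ∈ openChannel) :
    |dy (dy ψ) z| ≤ 2 * ε := by
  have hdxdx := abs_le.1 (hψ.abs_dx_dx_le hω hdx hz)
  have hωz := abs_le.1 (hsup z hz)
  have hpoisson := hψ.poisson z hz
  exact abs_le.2 ⟨by linarith, by linarith⟩

end DifferenceQuotient

section Flux

variable {E : Type*} [NormedAddCommGroup E] [NormedSpace ℝ E] {f G u : E → ℝ} {U : Set E}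

lemma contDiff_of_contDiffOn_of_tsupport_subset {n : WithTop ℕ∞} (hU : IsOpen U)
    (hf : ContDiffOn ℝ n f U) (hfU : tsupport f ⊆ U) : ContDiff ℝ n f :=
  contDiff_iff_contDiffAt.2 fun z => by
    by_cases hz : z ∈ tsupport f
    · exact hf.contDiffAt (hU.mem_nhds (hfU hz))
    · exact contDiffAt_const.congr_of_eventuallyEq (notMem_tsupport_iff_eventuallyEq.1 hz)

/-- The component in the direction `v` of the vector field `G ∇(u²) - u² ∇G`, whose divergence
gives the identity `∫ G |∇u|² = -∫ G u Δu + ½ ∫ u² ΔG` for a cutoff `G`. -/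
def energyFlux (v : E) (G u : E → ℝ) (z : E) : ℝ :=
  G z * (2 * (u z * dirDeriv v u z)) - u z * u z * dirDeriv v G z

lemma energyFlux_eq_zero_of_notMem_tsupport {z : E} (hz : z ∉ tsupport G) (v : E) (u : E → ℝ) :
    energyFlux v G u z = 0 := by
  simp [energyFlux, image_eq_zero_of_notMem_tsupport hz, dirDeriv_eq_zero_of_notMem_tsupport hz]

lemma tsupport_energyFlux_subset (v : E) (G u : E → ℝ) :
    tsupport (energyFlux v G u) ⊆ tsupport G :=
  closure_minimal (fun z hz => by
    by_contra hzG
    exact hz (energyFlux_eq_zero_of_notMem_tsupport hzG v u)) (isClosed_tsupport G)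

lemma contDiff_energyFlux (hU : IsOpen U) (hu : ContDiffOn ℝ 2 u U) (hG : ContDiff ℝ 2 G)
    (hGU : tsupport G ⊆ U) (v : E) : ContDiff ℝ 1 (energyFlux v G u) := by
  have hu1 : ContDiffOn ℝ 1 u U := hu.of_le (by norm_num)
  refine contDiff_of_contDiffOn_of_tsupport_subset hU ?_
    ((tsupport_energyFlux_subset v G u).trans hGU)
  exact ((hG.of_le (by norm_num)).contDiffOn.mul (contDiffOn_const.mul
      (hu1.mul (contDiffOn_dirDeriv hu hU (by norm_num) v)))).sub
    ((hu1.mul hu1).mul (contDiff_dirDeriv hG (by norm_num) v).contDiffOn)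

lemma dirDeriv_energyFlux (hU : IsOpen U) (hu : ContDiffOn ℝ 2 u U) (hG : ContDiff ℝ 2 G)
    (hGU : tsupport G ⊆ U) (v z : E) :
    dirDeriv v (energyFlux v G u) z =
      G z * (2 * dirDeriv v u z ^ 2 + 2 * u z * dirDeriv v (dirDeriv v u) z)
        - u z ^ 2 * dirDeriv v (dirDeriv v G) z := by
  by_cases hz : z ∈ tsupport G
  · have du := differentiableAt_of_contDiffOn hu hU two_ne_zero (hGU hz)
    have ddu := differentiableAt_of_contDiffOn
      (contDiffOn_dirDeriv (m := 1) hu hU (by norm_num) v) hU one_ne_zero (hGU hz)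
    have dG := hG.differentiable two_ne_zero z
    have ddG := (contDiff_dirDeriv (m := 1) hG (by norm_num) v).differentiable one_ne_zero z
    have dprod : DifferentiableAt ℝ (fun x => 2 * (u x * dirDeriv v u x)) z := by fun_prop
    have dsq : DifferentiableAt ℝ (fun x => u x * u x) z := by fun_prop
    have hflux : energyFlux v G u = fun x =>
        G x * (2 * (u x * dirDeriv v u x)) - u x * u x * dirDeriv v G x := rfl
    rw [hflux, dirDeriv_sub (dG.fun_mul dprod) (dsq.fun_mul ddG), dirDeriv_mul dG dprod,
      dirDeriv_const_mul]
    simp only [dirDeriv_mul du ddu, dirDeriv_mul dsq ddG, dirDeriv_mul du du]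
    ring
  · rw [dirDeriv_eq_zero_of_notMem_tsupport fun h => hz (tsupport_energyFlux_subset v G u h),
      image_eq_zero_of_notMem_tsupport hz,
      dirDeriv_eq_zero_of_notMem_tsupport fun h => hz (tsupport_dirDeriv_subset G v h)]
    ring

variable [MeasurableSpace E] [BorelSpace E] (μ : Measure E)

lemma integrable_dirDeriv [IsFiniteMeasureOnCompacts μ] (hf : ContDiff ℝ 1 f)
    (hfc : HasCompactSupport f) (v : E) : Integrable (dirDeriv v f) μ :=
  (contDiff_dirDeriv (m := 0) hf (by norm_num) v).continuous.integrable_of_hasCompactSupport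
    (hfc.fderiv_apply (𝕜 := ℝ) v)

lemma integral_dirDeriv_eq_zero [FiniteDimensional ℝ E] [μ.IsAddHaarMeasure]
    (hf : ContDiff ℝ 1 f) (hfc : HasCompactSupport f) (v : E) : ∫ z, dirDeriv v f z ∂μ = 0 := by
  have hparts := integral_mul_fderiv_eq_neg_fderiv_mul_of_integrable (μ := μ) (𝕜 := ℝ) (v := v)
    (f := fun _ : E => (1 : ℝ)) (g := f) (by simp)
    (by simpa only [one_mul] using! integrable_dirDeriv μ hf hfc v)
    (by simpa only [one_mul] using hf.continuous.integrable_of_hasCompactSupport hfc)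
    (fun _ _ => by fun_prop) (fun _ _ => hf.differentiable one_ne_zero _)
  simpa [dirDeriv] using hparts

end Flux

section Energy

variable {f G u ω ψ : ℝ × ℝ → ℝ} {z : ℝ × ℝ}

/-- The integrand of the localized energy identity of a solution of `-Δu = f`, with cutoff `G`. -/
def energyDensity (G f u : ℝ × ℝ → ℝ) (z : ℝ × ℝ) : ℝ :=
  G z * (2 * gradSq u z - 2 * u z * f z) - u z ^ 2 * lap G z

lemma energyDensity_eq_zero_of_notMem_tsupport (hz : z ∉ tsupport G) (f u : ℝ × ℝ → ℝ) :
    energyDensity G f u z = 0 := by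
  simp [energyDensity, image_eq_zero_of_notMem_tsupport hz, lap_eq_zero_of_notMem_tsupport hz]

lemma abs_energyDensity_le {C : ℝ} (hf : |f z| ≤ C) (hu : |u z| ≤ C) (hdx : |dx u z| ≤ C)
    (hdy : |dy u z| ≤ C) : |energyDensity G f u z| ≤ 6 * C ^ 2 * |G z| + C ^ 2 * |lap G z| := by
  have hC : 0 ≤ C := (abs_nonneg _).trans hf
  have hgrad : |2 * gradSq u z| ≤ 4 * C ^ 2 := by
    rw [gradSq, abs_of_nonneg (by positivity)]
    linarith [sq_le_sq.2 (hdx.trans (le_abs_self C)), sq_le_sq.2 (hdy.trans (le_abs_self C))]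
  have hsource : |2 * u z * f z| ≤ 2 * C ^ 2 := by
    rw [abs_mul, abs_mul, abs_two]
    nlinarith [mul_le_mul hu hf (abs_nonneg _) hC]
  have hbulk : |2 * gradSq u z - 2 * u z * f z| ≤ 6 * C ^ 2 :=
    (abs_sub _ _).trans (by linarith)
  refine (abs_sub _ _).trans (add_le_add ?_ ?_)
  · rw [abs_mul, mul_comm]
    gcongr
  · rw [abs_mul, abs_of_nonneg (sq_nonneg _)]
    exact mul_le_mul_of_nonneg_right (sq_le_sq.2 (hu.trans (le_abs_self C))) (abs_nonneg _)

namespace IsStreamFunction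

variable (hu : IsStreamFunction f u) (hG : ContDiff ℝ 2 G) (hGc : HasCompactSupport G)
  (hGU : tsupport G ⊆ openChannel)
include hu hG hGU

lemma energyDensity_eq_dirDeriv_energyFlux :
    energyDensity G f u = fun z => dirDeriv (1, 0) (energyFlux (1, 0) G u) z
      + dirDeriv (0, 1) (energyFlux (0, 1) G u) z := by
  funext z
  simp only [dirDeriv_energyFlux isOpen_openChannel hu.contDiffOn hG hGU]
  by_cases hz : z ∈ tsupport G
  · have hlap := hu.lap_eq (hGU hz)
    rw [lap_eq_dirDeriv] at hlap
    rw [energyDensity, gradSq, lap_eq_dirDeriv, dx_eq_dirDeriv, dy_eq_dirDeriv]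
    linear_combination -(2 * G z * u z) * hlap
  · rw [energyDensity_eq_zero_of_notMem_tsupport hz, image_eq_zero_of_notMem_tsupport hz]
    linear_combination u z ^ 2 *
      ((lap_eq_dirDeriv G z).symm.trans (lap_eq_zero_of_notMem_tsupport hz))

include hGc

lemma integrable_energyDensity : Integrable (energyDensity G f u) := by
  rw [hu.energyDensity_eq_dirDeriv_energyFlux hG hGU]
  have hflux := contDiff_energyFlux isOpen_openChannel hu.contDiffOn hG hGU
  exact (integrable_dirDeriv volume (hflux _)
      (hGc.of_isClosed_subset (isClosed_tsupport _) (tsupport_energyFlux_subset _ G u)) _).add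
    (integrable_dirDeriv volume (hflux _)
      (hGc.of_isClosed_subset (isClosed_tsupport _) (tsupport_energyFlux_subset _ G u)) _)

lemma integral_energyDensity_eq_zero : ∫ z, energyDensity G f u z = 0 := by
  rw [hu.energyDensity_eq_dirDeriv_energyFlux hG hGU]
  have hflux := contDiff_energyFlux isOpen_openChannel hu.contDiffOn hG hGU
  have hcompact : ∀ v, HasCompactSupport (energyFlux v G u) := fun v =>
    hGc.of_isClosed_subset (isClosed_tsupport _) (tsupport_energyFlux_subset v G u)
  rw [integral_add (integrable_dirDeriv volume (hflux _) (hcompact _) _)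
      (integrable_dirDeriv volume (hflux _) (hcompact _) _),
    integral_dirDeriv_eq_zero volume (hflux _) (hcompact _),
    integral_dirDeriv_eq_zero volume (hflux _) (hcompact _), add_zero]

end IsStreamFunction

lemma exists_abs_energyDensity_diffQuot_le (hψ : IsStreamFunction ω ψ)
    (hω : ContDiffOn ℝ 1 ω openChannel) (hGc : HasCompactSupport G)
    (hGU : tsupport G ⊆ openChannel) : ∃ C : ℝ, ∀ h ∈ Ioc (0 : ℝ) 1, ∀ z,
      |energyDensity G (diffQuot h ω) (diffQuot h ψ) z| ≤
        6 * C ^ 2 * |G z| + C ^ 2 * |lap G z| := by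
  have hbound := fun {f : ℝ × ℝ → ℝ} (hf : ContDiffOn ℝ 1 f openChannel) =>
    exists_abs_diffQuot_le hf hGc hGU
  obtain ⟨C₁, hC₁⟩ := hbound hω
  obtain ⟨C₂, hC₂⟩ := hbound hψ.contDiffOn_one
  obtain ⟨C₃, hC₃⟩ := hbound hψ.contDiffOn_dx
  obtain ⟨C₄, hC₄⟩ := hbound hψ.contDiffOn_dy
  refine ⟨max (max C₁ C₂) (max C₃ C₄), fun h hh z => ?_⟩
  by_cases hz : z ∈ tsupport G
  · have hdir : ∀ v, dirDeriv v (diffQuot h ψ) z = diffQuot h (dirDeriv v ψ) z := fun v =>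
      dirDeriv_diffQuot hψ.contDiffOn_one h v (hGU hz)
    refine abs_energyDensity_le ?_ ?_ ?_ ?_
    · exact (hC₁ z hz h hh).trans ((le_max_left _ _).trans (le_max_left _ _))
    · exact (hC₂ z hz h hh).trans ((le_max_right _ _).trans (le_max_left _ _))
    · rw [dx_eq_dirDeriv, hdir]
      exact (hC₃ z hz h hh).trans ((le_max_left _ _).trans (le_max_right _ _))
    · rw [dy_eq_dirDeriv, hdir]
      exact (hC₄ z hz h hh).trans ((le_max_right _ _).trans (le_max_right _ _))
  · rw [energyDensity_eq_zero_of_notMem_tsupport hz, abs_zero]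
    positivity

lemma tendsto_energyDensity_diffQuot (hψ : IsStreamFunction ω ψ)
    (hω : ContDiffOn ℝ 1 ω openChannel) (hGU : tsupport G ⊆ openChannel) (z : ℝ × ℝ) :
    Tendsto (fun h => energyDensity G (diffQuot h ω) (diffQuot h ψ) z) (𝓝[>] 0)
      (𝓝 (energyDensity G (dx ω) (dx ψ) z)) := by
  by_cases hz : z ∈ tsupport G
  · have hzU := hGU hz
    have hdir : ∀ v, Tendsto (fun h => dirDeriv v (diffQuot h ψ) z) (𝓝[>] 0)
        (𝓝 (dirDeriv v (dx ψ) z)) := fun v => by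
      simp only [dirDeriv_diffQuot hψ.contDiffOn_one _ v hzU]
      rw [dx_eq_dirDeriv, dirDeriv_dirDeriv_comm isOpen_openChannel hψ.contDiffOn hzU]
      exact tendsto_diffQuot (contDiffOn_dirDeriv hψ.contDiffOn isOpen_openChannel
        (by norm_num) v) hzU
    have hgrad := ((hdir (1, 0)).pow 2).add ((hdir (0, 1)).pow 2)
    have hψz := tendsto_diffQuot hψ.contDiffOn_one hzU
    exact (((hgrad.const_mul 2).sub ((hψz.const_mul 2).mul
      (tendsto_diffQuot hω hzU))).const_mul (G z)).sub ((hψz.pow 2).mul_const (lap G z))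
  · simp only [energyDensity_eq_zero_of_notMem_tsupport hz]
    exact tendsto_const_nhds

/-- `∂ₓψ` formally solves `-Δ(∂ₓψ) = ∂ₓω`, but it is only `C¹`, so the identity is obtained as a
limit of the identities for difference quotients. -/
lemma integral_energyDensity_dx_eq_zero (hψ : IsStreamFunction ω ψ)
    (hω : ContDiffOn ℝ 1 ω openChannel) (hG : ContDiff ℝ 2 G) (hGc : HasCompactSupport G)
    (hGU : tsupport G ⊆ openChannel) : ∫ z, energyDensity G (dx ω) (dx ψ) z = 0 := by
  obtain ⟨C, hC⟩ := exists_abs_energyDensity_diffQuot_le hψ hω hGc hGU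
  have hlapc : HasCompactSupport (lap G) :=
    hGc.of_isClosed_subset (isClosed_tsupport _) (tsupport_lap_subset G)
  have hdom : Integrable fun z => 6 * C ^ 2 * |G z| + C ^ 2 * |lap G z| :=
    ((hG.continuous.integrable_of_hasCompactSupport hGc).abs.const_mul _).add
      (((continuous_lap hG).integrable_of_hasCompactSupport hlapc).abs.const_mul _)
  have hlim := tendsto_integral_filter_of_dominated_convergence (l := 𝓝[>] (0 : ℝ)) _
    (Eventually.of_forall fun h =>
      ((hψ.diffQuot h).integrable_energyDensity hG hGc hGU).aestronglyMeasurable)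
    (by
      filter_upwards [Ioc_mem_nhdsGT (zero_lt_one' ℝ)] with h hh
      exact Eventually.of_forall (hC h hh))
    hdom
    (Eventually.of_forall (tendsto_energyDensity_diffQuot hψ hω hGU))
  simp only [(hψ.diffQuot _).integral_energyDensity_eq_zero hG hGc hGU] at hlim
  exact tendsto_nhds_unique hlim tendsto_const_nhds

end Energy

section Slice

lemma sq_integral_le {X : Type*} [MeasurableSpace X] {μ : Measure X} [IsFiniteMeasure μ]
    {g : X → ℝ} (hg : MemLp g 2 μ) : (∫ x, g x ∂μ) ^ 2 ≤ μ.real univ * ∫ x, g x ^ 2 ∂μ := by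
  rcases eq_zero_or_neZero μ with rfl | hμ
  · simp
  have hmass : 0 < μ.real univ := measureReal_univ_pos
  have hjensen := (even_two.convexOn_pow (𝕜 := ℝ)).map_average_le (by fun_prop) isClosed_univ
    (by simp) (hg.integrable (by norm_num)) hg.integrable_sq
  simp only [average_eq, smul_eq_mul, mul_pow] at hjensen
  have hscaled := mul_le_mul_of_nonneg_left hjensen (sq_nonneg (μ.real univ))
  field_simp at hscaled
  exact hscaled

variable {f f' p p' q r : ℝ → ℝ} {s : Set ℝ} {a b ε κ α Y y : ℝ}

lemma sq_sub_le_mul_lintegral [s.OrdConnected] (hf : ∀ y ∈ s, HasDerivAt f (f' y) y)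
    (hf' : ContinuousOn f' s) (hfin : ∫⁻ y in s, ENNReal.ofReal (f' y ^ 2) ≠ ∞) (ha : a ∈ s)
    (hb : b ∈ s) :
    (f b - f a) ^ 2 ≤ |b - a| * (∫⁻ y in s, ENNReal.ofReal (f' y ^ 2)).toReal := by
  wlog hab : a ≤ b generalizing a b
  · rw [abs_sub_comm, sub_sq_comm]
    exact this hb ha (le_of_not_ge hab)
  have hsub : Icc a b ⊆ s := Set.Icc_subset s ha hb
  have hcont : ContinuousOn f' (Icc a b) := hf'.mono hsub
  have hftc : ∫ t in Ioc a b, f' t = f b - f a := by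
    rw [← intervalIntegral.integral_of_le hab]
    exact intervalIntegral.integral_eq_sub_of_hasDerivAt
      (fun t ht => hf t (hsub (uIcc_of_le hab ▸ ht))) (hcont.intervalIntegrable_of_Icc hab)
  have hL2 : MemLp f' 2 (volume.restrict (Ioc a b)) :=
    (memLp_two_iff_integrable_sq ((hcont.mono Ioc_subset_Icc_self).aestronglyMeasurable
      measurableSet_Ioc)).2 ((hcont.pow 2).integrableOn_Icc.mono_set Ioc_subset_Icc_self)
  have hcs := sq_integral_le hL2
  rw [hftc, measureReal_restrict_apply_univ, Real.volume_real_Ioc_of_le hab] at hcs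
  rw [abs_of_nonneg (sub_nonneg.2 hab)]
  refine hcs.trans (mul_le_mul_of_nonneg_left ?_ (sub_nonneg.2 hab))
  rw [integral_eq_lintegral_of_nonneg_ae (Eventually.of_forall fun t => sq_nonneg _)
    hL2.integrable_sq.aestronglyMeasurable]
  exact ENNReal.toReal_mono hfin (lintegral_mono_set (Ioc_subset_Icc_self.trans hsub))

lemma sq_le_mul_lintegral_of_tendsto_zero [s.OrdConnected]
    (hf : ∀ y ∈ s, HasDerivAt f (f' y) y) (hf' : ContinuousOn f' s)
    (hfin : ∫⁻ y in s, ENNReal.ofReal (f' y ^ 2) ≠ ∞) {l : Filter ℝ} [l.NeBot] (hlY : l ≤ 𝓝 Y)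
    (hls : ∀ᶠ y in l, y ∈ s) (hfl : Tendsto f l (𝓝 0)) (hy : y ∈ s) :
    f y ^ 2 ≤ |y - Y| * (∫⁻ y in s, ENNReal.ofReal (f' y ^ 2)).toReal := by
  have hleft : Tendsto (fun t => (f y - f t) ^ 2) l (𝓝 ((f y - 0) ^ 2)) :=
    (hfl.const_sub (f y)).pow 2
  rw [sub_zero] at hleft
  refine le_of_tendsto_of_tendsto hleft
    (((tendsto_id.mono_right hlY).const_sub y).abs.mul_const _) ?_
  filter_upwards [hls] with t ht using sq_sub_le_mul_lintegral hf hf' hfin ht hy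

lemma exists_mul_abs_sub_le_abs (hab : a < b) (hp : ContinuousOn p (Ioo a b))
    (hsteep : ∀ y ∈ Ioo a b, ∀ y' ∈ Ioo a b, y ≤ y' → κ * (y' - y) ≤ p y' - p y) :
    ∃ Y ∈ Icc a b, (Y ∈ Ioo a b → p Y = 0) ∧ ∀ y ∈ Ioo a b, κ * |y - Y| ≤ |p y| := by
  by_cases hzero : ∃ Y ∈ Ioo a b, p Y = 0
  · obtain ⟨Y, hY, hpY⟩ := hzero
    refine ⟨Y, Ioo_subset_Icc_self hY, fun _ => hpY, fun y hy => ?_⟩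
    rcases le_total Y y with hYy | hyY
    · rw [abs_of_nonneg (sub_nonneg.2 hYy)]
      linarith [hsteep Y hY y hy hYy, le_abs_self (p y)]
    · rw [abs_of_nonpos (sub_nonpos.2 hyY)]
      linarith [hsteep y hy Y hY hyY, neg_le_abs (p y)]
  have hsign : (∀ y ∈ Ioo a b, 0 < p y) ∨ ∀ y ∈ Ioo a b, p y < 0 := by
    push Not at hzero
    by_contra! hcon
    obtain ⟨⟨y, hy, hpy⟩, y', hy', hpy'⟩ := hcon
    obtain ⟨Y, hY, hpY⟩ := isPreconnected_Ioo.intermediate_value hy hy' hp ⟨hpy, hpy'⟩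
    exact hzero Y hY hpY
  have hlim : ∀ y Y : ℝ, Tendsto (fun t => κ * |y - t|) (𝓝 Y) (𝓝 (κ * |y - Y|)) := fun y Y =>
    (tendsto_id.const_sub y).abs.const_mul κ
  rcases hsign with hpos | hneg
  · refine ⟨a, left_mem_Icc.2 hab.le, fun h => (lt_irrefl a h.1).elim, fun y hy => ?_⟩
    refine le_of_tendsto ((hlim y a).mono_left (nhdsWithin_le_nhds (s := Ioi a))) ?_
    filter_upwards [Ioo_mem_nhdsGT hy.1] with t ht
    have hta : t ∈ Ioo a b := ⟨ht.1, ht.2.trans hy.2⟩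
    rw [abs_of_pos (sub_pos.2 ht.2)]
    linarith [hsteep t hta y hy ht.2.le, hpos t hta, le_abs_self (p y)]
  · refine ⟨b, right_mem_Icc.2 hab.le, fun h => (lt_irrefl b h.2).elim, fun y hy => ?_⟩
    refine le_of_tendsto ((hlim y b).mono_left (nhdsWithin_le_nhds (s := Iio b))) ?_
    filter_upwards [Ioo_mem_nhdsLT hy.2] with t ht
    have htb : t ∈ Ioo a b := ⟨hy.1.trans ht.1, ht.2⟩
    rw [abs_of_neg (sub_neg.2 ht.1)]
    linarith [hsteep y hy t htb ht.1.le, hneg t htb, neg_le_abs (p y)]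

lemma abs_mul_le_div_of_mul_eq {F P Q R B d : ℝ} (hκ : 0 < κ) (hd : 0 < d) (hP : κ * d ≤ |P|)
    (hPQ : P * Q = F * R) (hB : F ^ 2 * |R| ≤ d * B) : |F * Q| ≤ B / κ := by
  rw [le_div_iff₀ hκ]
  refine le_of_mul_le_mul_left ?_ hd
  calc d * (|F * Q| * κ) = κ * d * |F * Q| := by ring
    _ ≤ |P| * |F * Q| := by gcongr
    _ = |F * (P * Q)| := by rw [← abs_mul]; ring_nf
    _ = F ^ 2 * |R| := by rw [hPQ, ← mul_assoc, abs_mul, ← sq, abs_of_nonneg (sq_nonneg F)]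
    _ ≤ d * B := hB

/-- The integral that bounds, on every slice of length `L`, the singularity `|y - Y| ^ (α - 1)` at
the critical layer `Y`. -/
def sliceConst (α L : ℝ) : ℝ≥0∞ :=
  ∫⁻ t in Ioo (-L) L, ENNReal.ofReal (1 + L * |t| ^ (α - 1))

lemma integrableOn_abs_rpow (hα : -1 < α) (L : ℝ) :
    IntegrableOn (fun t : ℝ => |t| ^ α) (Ioo (-L) L) := by
  have hball := integrableOn_ball_of_norm_le_rpow (μ := (volume : Measure ℝ)) (C := 1) (α := -α)
    (r := L) (f := fun t : ℝ => |t| ^ α) (by simp) (by simpa using neg_lt.1 hα)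
    (ae_of_all _ fun t => by simp [Real.abs_rpow_of_nonneg])
    (measurable_id.abs.pow_const α).aestronglyMeasurable
  simpa [Real.ball_eq_Ioo] using hball

lemma sliceConst_ne_top (hα : 0 < α) (L : ℝ) : sliceConst α L ≠ ∞ :=
  ((integrableOn_const (by simp)).add
    ((integrableOn_abs_rpow (by linarith) L).const_mul L)).lintegral_lt_top.ne

lemma sliceConst_ne_zero (α : ℝ) {L : ℝ} (hL : 0 < L) : sliceConst α L ≠ 0 := by
  refine (lt_of_lt_of_le ?_ (lintegral_mono fun t => ENNReal.one_le_ofReal.2 ?_)).ne'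
  · simpa using hL
  · exact le_add_of_nonneg_right (by positivity)

lemma lintegral_sub_le_sliceConst (α : ℝ) (hY : Y ∈ Icc a b) :
    ∫⁻ y in Ioo a b, ENNReal.ofReal (1 + (b - a) * |y - Y| ^ (α - 1)) ≤ sliceConst α (b - a) := by
  rw [sliceConst, ← lintegral_indicator measurableSet_Ioo, ← lintegral_indicator measurableSet_Ioo,
    ← lintegral_sub_right_eq_self (fun t => (Ioo (-(b - a)) (b - a)).indicator
      (fun t => ENNReal.ofReal (1 + (b - a) * |t| ^ (α - 1))) t) Y]
  refine lintegral_mono fun y => ?_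
  by_cases hy : y ∈ Ioo a b
  · rw [indicator_of_mem hy, indicator_of_mem]
    exact ⟨by linarith [hy.1, hY.2], by linarith [hy.2, hY.1]⟩
  · simp [indicator_of_notMem hy]

variable (hab : a < b) (hε : 0 < ε) (hκ : 0 < κ)
  (hf : ∀ y ∈ Ioo a b, HasDerivAt f (f' y) y) (hf' : ContinuousOn f' (Ioo a b))
  (hfa : Tendsto f (𝓝[>] a) (𝓝 0)) (hfb : Tendsto f (𝓝[<] b) (𝓝 0))
  (hp : ∀ y ∈ Ioo a b, HasDerivAt p (p' y) y) (hp' : ∀ y ∈ Ioo a b, κ ≤ p' y)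
  (hpq : ∀ y ∈ Ioo a b, p y * q y = f y * r y) (hr : ∀ y ∈ Ioo a b, |r y| ≤ ε)
  (hrα : ∀ y ∈ Ioo a b, ∀ y' ∈ Ioo a b, y ≠ y' → |r y - r y'| ≤ ε * |y - y'| ^ α)

include hab hf hf' hfa hfb in
lemma sq_le_mul_lintegral_of_tendsto_endpoints
    (hfin : ∫⁻ y in Ioo a b, ENNReal.ofReal (f' y ^ 2) ≠ ∞) (hY : Y ∈ Icc a b)
    (hfY : Y ∈ Ioo a b → f Y = 0) (hy : y ∈ Ioo a b) :
    f y ^ 2 ≤ |y - Y| * (∫⁻ y in Ioo a b, ENNReal.ofReal (f' y ^ 2)).toReal := by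
  rcases eq_endpoints_or_mem_Ioo_of_mem_Icc hY with rfl | rfl | hYab
  · exact sq_le_mul_lintegral_of_tendsto_zero hf hf' hfin nhdsWithin_le_nhds
      (Ioo_mem_nhdsGT hab) hfa hy
  · exact sq_le_mul_lintegral_of_tendsto_zero hf hf' hfin nhdsWithin_le_nhds
      (Ioo_mem_nhdsLT hab) hfb hy
  · have hfY0 : Tendsto f (𝓝 Y) (𝓝 0) := hfY hYab ▸ (hf Y hYab).continuousAt.tendsto
    exact sq_le_mul_lintegral_of_tendsto_zero hf hf' hfin le_rfl (Ioo_mem_nhds hYab.1 hYab.2)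
      hfY0 hy

include hab hε hf hf' hfa hfb hpq hr hrα

/-- At the critical layer `Y`, where `p` vanishes, either `f` or `r` vanishes: in the first case
`f² ≤ |y - Y| ∫ f'²`, in the second `|r| ≤ ε |y - Y| ^ α`. -/
lemma sq_mul_abs_le_of_mul_eq (hfin : ∫⁻ y in Ioo a b, ENNReal.ofReal (f' y ^ 2) ≠ ∞)
    (hY : Y ∈ Icc a b) (hpY : Y ∈ Ioo a b → p Y = 0) (hy : y ∈ Ioo a b) (hne : y ≠ Y) :
    f y ^ 2 * |r y| ≤ |y - Y| * (ε * (∫⁻ y in Ioo a b, ENNReal.ofReal (f' y ^ 2)).toReal *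
      (1 + (b - a) * |y - Y| ^ (α - 1))) := by
  set A := (∫⁻ y in Ioo a b, ENNReal.ofReal (f' y ^ 2)).toReal
  have hd : 0 < |y - Y| := abs_pos.2 (sub_ne_zero.2 hne)
  have : 0 ≤ b - a := sub_nonneg.2 hab.le
  by_cases hfY : Y ∈ Ioo a b → f Y = 0
  · calc f y ^ 2 * |r y| ≤ |y - Y| * A * ε := by
          gcongr
          exacts [sq_le_mul_lintegral_of_tendsto_endpoints hab hf hf' hfa hfb hfin hY hfY hy,
            hr y hy]
      _ = |y - Y| * (ε * A * 1) := by ring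
      _ ≤ _ := by
          gcongr
          exact le_add_of_nonneg_right (by positivity)
  · push Not at hfY
    obtain ⟨hYab, hfY⟩ := hfY
    have hrY : r Y = 0 := by simpa [hpY hYab, hfY] using hpq Y hYab
    have hry : |r y| ≤ ε * (|y - Y| * |y - Y| ^ (α - 1)) := by
      rw [Real.rpow_sub_one hd.ne', mul_div_cancel₀ _ hd.ne']
      simpa [hrY] using hrα y hy Y hYab hne
    have hfsq : f y ^ 2 ≤ (b - a) * A := by
      refine (sq_le_mul_lintegral_of_tendsto_endpoints hab hf hf' hfa hfb hfin
        (left_mem_Icc.2 hab.le) (fun h => (lt_irrefl a h.1).elim) hy).trans ?_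
      rw [abs_of_pos (sub_pos.2 hy.1)]
      gcongr
      exact hy.2.le
    calc f y ^ 2 * |r y| ≤ (b - a) * A * (ε * (|y - Y| * |y - Y| ^ (α - 1))) := by gcongr
      _ = |y - Y| * (ε * A * ((b - a) * |y - Y| ^ (α - 1))) := by ring
      _ ≤ _ := by
          gcongr
          exact le_add_of_nonneg_left zero_le_one

include hκ hp hp'

lemma exists_abs_mul_le_of_mul_eq (hfin : ∫⁻ y in Ioo a b, ENNReal.ofReal (f' y ^ 2) ≠ ∞) :
    ∃ Y ∈ Icc a b, ∀ y ∈ Ioo a b, y ≠ Y → |f y * q y| ≤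
      ε / κ * (∫⁻ y in Ioo a b, ENNReal.ofReal (f' y ^ 2)).toReal *
        (1 + (b - a) * |y - Y| ^ (α - 1)) := by
  obtain ⟨Y, hY, hpY, hsteep⟩ := exists_mul_abs_sub_le_abs (κ := κ) hab
    (fun y hy => (hp y hy).continuousAt.continuousWithinAt)
    ((convex_Ioo a b).mul_sub_le_image_sub_of_le_deriv
      (fun y hy => (hp y hy).continuousAt.continuousWithinAt)
      (fun y hy => (hp y (interior_subset hy)).differentiableAt.differentiableWithinAt)
      (fun y hy => (hp y (interior_subset hy)).deriv ▸ hp' y (interior_subset hy)))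
  refine ⟨Y, hY, fun y hy hne => ?_⟩
  exact (abs_mul_le_div_of_mul_eq hκ (abs_pos.2 (sub_ne_zero.2 hne)) (hsteep y hy) (hpq y hy)
    (sq_mul_abs_le_of_mul_eq hab hε hf hf' hfa hfb hpq hr hrα hfin hY hpY hy hne)).trans_eq
      (by ring)

lemma lintegral_abs_mul_le_sliceConst :
    ∫⁻ y in Ioo a b, ENNReal.ofReal |f y * q y| ≤ ENNReal.ofReal (ε / κ) * sliceConst α (b - a) *
      ∫⁻ y in Ioo a b, ENNReal.ofReal (f' y ^ 2) := by
  by_cases hfin : ∫⁻ y in Ioo a b, ENNReal.ofReal (f' y ^ 2) = ∞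
  · rw [hfin, ENNReal.mul_top]
    · exact le_top
    · exact mul_ne_zero (by simpa using div_pos hε hκ) (sliceConst_ne_zero α (sub_pos.2 hab))
  obtain ⟨Y, hY, hbound⟩ :=
    exists_abs_mul_le_of_mul_eq hab hε hκ hf hf' hfa hfb hp hp' hpq hr hrα hfin
  set A := (∫⁻ y in Ioo a b, ENNReal.ofReal (f' y ^ 2)).toReal
  have hcoef : 0 ≤ ε / κ * A := mul_nonneg (div_pos hε hκ).le ENNReal.toReal_nonneg
  calc ∫⁻ y in Ioo a b, ENNReal.ofReal |f y * q y|
      ≤ ∫⁻ y in Ioo a b, ENNReal.ofReal (ε / κ * A) *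
          ENNReal.ofReal (1 + (b - a) * |y - Y| ^ (α - 1)) := by
        refine lintegral_mono_ae ?_
        filter_upwards [ae_restrict_mem measurableSet_Ioo,
          ae_restrict_of_ae (Measure.ae_ne volume Y)] with y hy hyY
        rw [← ENNReal.ofReal_mul hcoef]
        exact ENNReal.ofReal_le_ofReal (hbound y hy hyY)
    _ = ENNReal.ofReal (ε / κ * A) *
          ∫⁻ y in Ioo a b, ENNReal.ofReal (1 + (b - a) * |y - Y| ^ (α - 1)) :=
        lintegral_const_mul' _ _ ENNReal.ofReal_ne_top
    _ ≤ ENNReal.ofReal (ε / κ * A) * sliceConst α (b - a) := by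
        gcongr
        exact lintegral_sub_le_sliceConst α hY
    _ = _ := by
        rw [ENNReal.ofReal_mul (div_pos hε hκ).le, ENNReal.ofReal_toReal hfin, mul_right_comm]

end Slice

section Cutoff

open Real (smoothTransition)

lemma tsupport_deriv_smoothTransition_subset : tsupport (deriv smoothTransition) ⊆ Icc 0 1 := by
  refine closure_minimal (fun t ht => ?_) isClosed_Icc
  by_contra htI
  rw [mem_Icc, not_and_or, not_le, not_le] at htI
  refine ht ?_
  rcases htI with h | h
  · have hzero : smoothTransition =ᶠ[𝓝 t] fun _ => 0 := by
      filter_upwards [Iio_mem_nhds h] with s hs using smoothTransition.zero_of_nonpos (le_of_lt hs)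
    simp [hzero.deriv_eq]
  · have hone : smoothTransition =ᶠ[𝓝 t] fun _ => 1 := by
      filter_upwards [Ioi_mem_nhds h] with s hs using smoothTransition.one_of_one_le (le_of_lt hs)
    simp [hone.deriv_eq]

lemma contDiff_deriv_smoothTransition : ContDiff ℝ 1 (deriv smoothTransition) := by
  simpa using (smoothTransition.contDiff (n := 2)).iterate_deriv' 1 1

lemma exists_abs_deriv_smoothTransition_le : ∃ C : ℝ, ∀ t,
    |deriv smoothTransition t| ≤ C ∧ |deriv (deriv smoothTransition) t| ≤ C := by
  have hcompact : HasCompactSupport (deriv smoothTransition) :=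
    isCompact_Icc.of_isClosed_subset (isClosed_tsupport _) tsupport_deriv_smoothTransition_subset
  obtain ⟨C₁, hC₁⟩ := hcompact.exists_bound_of_continuous contDiff_deriv_smoothTransition.continuous
  obtain ⟨C₂, hC₂⟩ := hcompact.deriv.exists_bound_of_continuous
    (contDiff_deriv_smoothTransition.continuous_deriv le_rfl)
  exact ⟨max C₁ C₂, fun t => ⟨(hC₁ t).trans (le_max_left _ _), (hC₂ t).trans (le_max_right _ _)⟩⟩

/-- The smooth cutoff equal to `1` where `b t² ≤ a - 1` and to `0` where `b t² ≥ a`. -/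
def cutoff (a b t : ℝ) : ℝ := smoothTransition (a - b * t ^ 2)

variable {a b t : ℝ}

lemma contDiff_cutoff (a b : ℝ) : ContDiff ℝ 2 (cutoff a b) :=
  (smoothTransition.contDiff (n := 2)).comp (by fun_prop)

lemma cutoff_nonneg (a b t : ℝ) : 0 ≤ cutoff a b t := smoothTransition.nonneg _

lemma cutoff_le_one (a b t : ℝ) : cutoff a b t ≤ 1 := smoothTransition.le_one _

lemma cutoff_ne_zero : cutoff a b t ≠ 0 ↔ 0 < a - b * t ^ 2 := by
  rw [cutoff, Ne, smoothTransition.zero_iff_nonpos, not_le]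

lemma cutoff_eq_one (h : 1 ≤ a - b * t ^ 2) : cutoff a b t = 1 :=
  smoothTransition.one_of_one_le h

lemma deriv_deriv_cutoff (a b t : ℝ) : deriv (deriv (cutoff a b)) t =
    deriv (deriv smoothTransition) (a - b * t ^ 2) * (2 * b * t) ^ 2
      - deriv smoothTransition (a - b * t ^ 2) * (2 * b) := by
  have hquad : ∀ t : ℝ, HasDerivAt (fun t : ℝ => a - b * t ^ 2) (-(2 * b * t)) t := fun t =>
    (((hasDerivAt_pow 2 t).const_mul b).const_sub a).congr_deriv (by norm_num; ring)
  have hfirst : deriv (cutoff a b) =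
      fun t => deriv smoothTransition (a - b * t ^ 2) * -(2 * b * t) := funext fun t =>
    (((smoothTransition.contDiff (n := 1)).differentiable one_ne_zero _).hasDerivAt.comp t
      (hquad t)).deriv
  have hlinear : HasDerivAt (fun t : ℝ => -(2 * b * t)) (-(2 * b)) t := by
    simpa using ((hasDerivAt_id t).const_mul (2 * b)).fun_neg
  have hsecond := (((contDiff_deriv_smoothTransition.differentiable one_ne_zero _).hasDerivAt.comp t
    (hquad t)).mul hlinear).deriv
  rw [hfirst]
  exact hsecond.trans (by simp only [Function.comp_apply]; ring)

lemma deriv_deriv_cutoff_eq_zero (h : a - b * t ^ 2 ∉ Icc (0 : ℝ) 1) :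
    deriv (deriv (cutoff a b)) t = 0 := by
  have hfirst : a - b * t ^ 2 ∉ tsupport (deriv smoothTransition) := fun hmem =>
    h (tsupport_deriv_smoothTransition_subset hmem)
  rw [deriv_deriv_cutoff, image_eq_zero_of_notMem_tsupport hfirst,
    deriv_of_notMem_tsupport hfirst]
  ring

lemma abs_deriv_deriv_cutoff_le {C : ℝ} (hC : ∀ t, |deriv smoothTransition t| ≤ C ∧
    |deriv (deriv smoothTransition) t| ≤ C) (hb : 0 ≤ b) :
    |deriv (deriv (cutoff a b)) t| ≤ C * (4 * b * (b * t ^ 2) + 2 * b) := by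
  rw [deriv_deriv_cutoff]
  calc _ ≤ |deriv (deriv smoothTransition) (a - b * t ^ 2)| * (2 * b * t) ^ 2
        + |deriv smoothTransition (a - b * t ^ 2)| * (2 * b) := by
        refine (abs_sub _ _).trans_eq ?_
        rw [abs_mul, abs_mul, abs_of_nonneg (sq_nonneg (2 * b * t)),
          abs_of_nonneg (by positivity : 0 ≤ 2 * b)]
    _ ≤ C * (2 * b * t) ^ 2 + C * (2 * b) := by
        gcongr
        exacts [(hC _).2, (hC _).1]
    _ = _ := by ring

end Cutoff

section Weight

open Real (smoothTransition)

variable {C R m x y : ℝ} {z : ℝ × ℝ}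

/-- The cutoff at horizontal scale `R`. -/
def horizontalCutoff (R : ℝ) : ℝ → ℝ := cutoff 2 (R⁻¹ ^ 2)

/-- The cutoff that removes layers of thickness of order `1 / m` along the walls `y = ±1`. -/
def verticalCutoff (m : ℝ) : ℝ → ℝ := cutoff (m - 1) m

lemma mem_Icc_of_horizontalCutoff_arg_nonneg (hR : 0 < R) (h : 0 ≤ 2 - R⁻¹ ^ 2 * x ^ 2) :
    x ∈ Icc (-(2 * R)) (2 * R) := by
  have hx : x ^ 2 ≤ 2 * R ^ 2 := by
    have hscale : R⁻¹ ^ 2 * x ^ 2 * R ^ 2 = x ^ 2 := by field_simp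
    nlinarith [sq_nonneg R]
  exact abs_le.1 (abs_le_of_sq_le_sq (by nlinarith) (by positivity))

lemma horizontalCutoff_eq_zero (hR : 0 < R) (hx : x ∉ Icc (-(2 * R)) (2 * R)) :
    horizontalCutoff R x = 0 := by
  contrapose! hx
  exact mem_Icc_of_horizontalCutoff_arg_nonneg hR (cutoff_ne_zero.1 hx).le

lemma deriv_deriv_horizontalCutoff_eq_zero (hR : 0 < R) (hx : x ∉ Icc (-(2 * R)) (2 * R)) :
    deriv (deriv (horizontalCutoff R)) x = 0 :=
  deriv_deriv_cutoff_eq_zero fun h => hx (mem_Icc_of_horizontalCutoff_arg_nonneg hR h.1)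

lemma eventually_horizontalCutoff_eq_one (x : ℝ) : ∀ᶠ R in atTop, horizontalCutoff R x = 1 := by
  have hlim : Tendsto (fun R : ℝ => 2 - R⁻¹ ^ 2 * x ^ 2) atTop (𝓝 (2 - 0 ^ 2 * x ^ 2)) :=
    ((tendsto_inv_atTop_zero.pow 2).mul_const _).const_sub 2
  filter_upwards [hlim.eventually_const_lt (u := 1) (by norm_num)] with R hR
  exact cutoff_eq_one hR.le

lemma eventually_one_lt_verticalCutoff_arg (hy : y ∈ Ioo (-1 : ℝ) 1) :
    ∀ᶠ m : ℝ in atTop, 1 < m - 1 - m * y ^ 2 := by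
  have hpos : 0 < 1 - y ^ 2 := by nlinarith [hy.1, hy.2]
  filter_upwards [(tendsto_id.atTop_mul_const hpos).eventually_gt_atTop 2] with m hm
  simp only [id] at hm
  linarith

lemma abs_deriv_deriv_horizontalCutoff_le (hC : ∀ t, |deriv smoothTransition t| ≤ C ∧
    |deriv (deriv smoothTransition) t| ≤ C) (R x : ℝ) :
    |deriv (deriv (horizontalCutoff R)) x| ≤ 10 * C * R⁻¹ ^ 2 := by
  have hC0 : 0 ≤ C := (abs_nonneg _).trans (hC 0).1
  by_cases h : 2 - R⁻¹ ^ 2 * x ^ 2 ∈ Icc (0 : ℝ) 1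
  · calc |deriv (deriv (horizontalCutoff R)) x|
        ≤ C * (4 * R⁻¹ ^ 2 * (R⁻¹ ^ 2 * x ^ 2) + 2 * R⁻¹ ^ 2) :=
          abs_deriv_deriv_cutoff_le hC (sq_nonneg _)
      _ ≤ C * (4 * R⁻¹ ^ 2 * 2 + 2 * R⁻¹ ^ 2) := by
          gcongr
          linarith [h.1]
      _ = 10 * C * R⁻¹ ^ 2 := by ring
  · rw [horizontalCutoff, deriv_deriv_cutoff_eq_zero h, abs_zero]
    positivity

lemma sq_mul_abs_deriv_deriv_verticalCutoff_le (hC : ∀ t, |deriv smoothTransition t| ≤ C ∧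
    |deriv (deriv smoothTransition) t| ≤ C) (hm : 0 ≤ m) (hy : y ∈ Ioo (-1 : ℝ) 1) :
    (1 - y ^ 2) ^ 2 * |deriv (deriv (verticalCutoff m)) y| ≤ 24 * C := by
  have hC0 : 0 ≤ C := (abs_nonneg _).trans (hC 0).1
  have hy2 : 0 < 1 - y ^ 2 := by nlinarith [hy.1, hy.2]
  by_cases h : m - 1 - m * y ^ 2 ∈ Icc (0 : ℝ) 1
  · have hlayer : m * (1 - y ^ 2) ≤ 2 := by linarith [h.2]
    have hm1 : 1 ≤ m := by linarith [h.1, mul_nonneg hm (sq_nonneg y)]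
    calc (1 - y ^ 2) ^ 2 * |deriv (deriv (verticalCutoff m)) y|
        ≤ (1 - y ^ 2) ^ 2 * (C * (4 * m * (m * y ^ 2) + 2 * m)) := by
          gcongr
          exact abs_deriv_deriv_cutoff_le hC hm
      _ ≤ (1 - y ^ 2) ^ 2 * (C * (4 * m * (m * 1) + 2 * (m * m))) := by
          gcongr
          · linarith
          · exact le_mul_of_one_le_left hm hm1
      _ = 6 * C * (m * (1 - y ^ 2)) ^ 2 := by ring
      _ ≤ 6 * C * 2 ^ 2 := by gcongr
      _ = 24 * C := by ring
  · rw [verticalCutoff, deriv_deriv_cutoff_eq_zero h, abs_zero, mul_zero]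
    positivity

/-- The compactly supported cutoff in the open channel used to localize the energy identity. -/
def weight (R m : ℝ) (z : ℝ × ℝ) : ℝ := horizontalCutoff R z.1 * verticalCutoff m z.2

lemma contDiff_weight (R m : ℝ) : ContDiff ℝ 2 (weight R m) :=
  ((contDiff_cutoff _ _).comp contDiff_fst).mul ((contDiff_cutoff _ _).comp contDiff_snd)

lemma weight_nonneg (R m : ℝ) (z : ℝ × ℝ) : 0 ≤ weight R m z :=
  mul_nonneg (cutoff_nonneg _ _ _) (cutoff_nonneg _ _ _)

lemma weight_le_horizontalCutoff (R m : ℝ) (z : ℝ × ℝ) : weight R m z ≤ horizontalCutoff R z.1 :=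
  mul_le_of_le_one_right (cutoff_nonneg _ _ _) (cutoff_le_one _ _ _)

lemma lap_weight (R m : ℝ) (z : ℝ × ℝ) :
    lap (weight R m) z = deriv (deriv (horizontalCutoff R)) z.1 * verticalCutoff m z.2
      + horizontalCutoff R z.1 * deriv (deriv (verticalCutoff m)) z.2 :=
  lap_mul_fst_snd (contDiff_cutoff _ _) (contDiff_cutoff _ _) z

lemma tsupport_weight_subset (hR : 0 < R) (hm : 0 < m) : tsupport (weight R m) ⊆
    Icc (-(2 * R)) (2 * R) ×ˢ Icc (-√(1 - m⁻¹)) (√(1 - m⁻¹)) := by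
  refine closure_minimal (fun z hz => ?_) (isClosed_Icc.prod isClosed_Icc)
  obtain ⟨hx, hy⟩ := mul_ne_zero_iff.1 hz
  have hy' := cutoff_ne_zero.1 hy
  refine ⟨by_contra fun h => hx (horizontalCutoff_eq_zero hR h),
    abs_le.1 (Real.abs_le_sqrt ?_)⟩
  rw [le_sub_comm, inv_le_iff_one_le_mul₀ hm]
  linarith

lemma hasCompactSupport_weight (hR : 0 < R) (hm : 0 < m) : HasCompactSupport (weight R m) :=
  (isCompact_Icc.prod isCompact_Icc).of_isClosed_subset (isClosed_tsupport _)
    (tsupport_weight_subset hR hm)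

lemma tsupport_weight_subset_openChannel (hR : 0 < R) (hm : 0 < m) :
    tsupport (weight R m) ⊆ openChannel := by
  intro z hz
  obtain ⟨-, hlower, hupper⟩ := tsupport_weight_subset hR hm hz
  have hsqrt : √(1 - m⁻¹) < 1 := by
    rw [Real.sqrt_lt' one_pos, one_pow, sub_lt_self_iff]
    exact inv_pos.2 hm
  exact mem_openChannel.2 ⟨by linarith, by linarith⟩

lemma eventually_weight_eq (R : ℝ) (hz : z ∈ openChannel) :
    ∀ᶠ m in atTop, weight R m z = horizontalCutoff R z.1 := by
  filter_upwards [eventually_one_lt_verticalCutoff_arg (mem_openChannel.1 hz)] with m hm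
  rw [weight, verticalCutoff, cutoff_eq_one hm.le, mul_one]

lemma eventually_lap_weight_eq (R : ℝ) (hz : z ∈ openChannel) :
    ∀ᶠ m in atTop, lap (weight R m) z = deriv (deriv (horizontalCutoff R)) z.1 := by
  filter_upwards [eventually_one_lt_verticalCutoff_arg (mem_openChannel.1 hz)] with m hm
  rw [lap_weight, verticalCutoff, cutoff_eq_one hm.le,
    deriv_deriv_cutoff_eq_zero fun h => hm.not_ge h.2, mul_one, mul_zero, add_zero]

/-- The factor `(1 - y²)²`, provided by the vanishing of `u` on the walls, absorbs the growth of the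
second derivative of `verticalCutoff m` as `m → ∞`. -/
lemma sq_mul_abs_lap_weight_le {u : ℝ × ℝ → ℝ} {δ : ℝ} (hC : ∀ t, |deriv smoothTransition t| ≤ C ∧
    |deriv (deriv smoothTransition) t| ≤ C) (hR : 0 < R) (hm : 0 ≤ m) (hz : z ∈ openChannel)
    (hu : |u z| ≤ δ * (1 - z.2 ^ 2)) : u z ^ 2 * |lap (weight R m) z| ≤
      (Icc (-(2 * R)) (2 * R)).indicator (fun _ => δ ^ 2 * (10 * C * R⁻¹ ^ 2 + 24 * C)) z.1 := by
  by_cases hx : z.1 ∈ Icc (-(2 * R)) (2 * R)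
  · have hC0 : 0 ≤ C := (abs_nonneg _).trans (hC 0).1
    have hy : z.2 ∈ Ioo (-1) 1 := mem_openChannel.1 hz
    have hy1 : (1 - z.2 ^ 2) ^ 2 ≤ 1 := by
      have := sq_snd_le_one (openChannel_subset_channel hz)
      nlinarith [sq_nonneg z.2]
    have hlap : |lap (weight R m) z| ≤
        10 * C * R⁻¹ ^ 2 + |deriv (deriv (verticalCutoff m)) z.2| := by
      rw [lap_weight]
      refine (abs_add_le _ _).trans (add_le_add ?_ ?_)
      · rw [abs_mul, abs_of_nonneg (show 0 ≤ verticalCutoff m z.2 from cutoff_nonneg _ _ _)]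
        exact (mul_le_of_le_one_right (abs_nonneg _) (cutoff_le_one _ _ _)).trans
          (abs_deriv_deriv_horizontalCutoff_le hC R z.1)
      · rw [abs_mul, abs_of_nonneg (show 0 ≤ horizontalCutoff R z.1 from cutoff_nonneg _ _ _)]
        exact mul_le_of_le_one_left (abs_nonneg _) (cutoff_le_one _ _ _)
    rw [indicator_of_mem hx]
    calc u z ^ 2 * |lap (weight R m) z|
        ≤ (δ * (1 - z.2 ^ 2)) ^ 2 *
            (10 * C * R⁻¹ ^ 2 + |deriv (deriv (verticalCutoff m)) z.2|) := by
          rw [← sq_abs (u z)]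
          gcongr
      _ = δ ^ 2 * (10 * C * R⁻¹ ^ 2 * (1 - z.2 ^ 2) ^ 2 +
            (1 - z.2 ^ 2) ^ 2 * |deriv (deriv (verticalCutoff m)) z.2|) := by ring
      _ ≤ δ ^ 2 * (10 * C * R⁻¹ ^ 2 + 24 * C) :=
          mul_le_mul_of_nonneg_left (add_le_add (mul_le_of_le_one_right (by positivity) hy1)
            (sq_mul_abs_deriv_deriv_verticalCutoff_le hC hm hy)) (sq_nonneg δ)
  · rw [lap_weight, horizontalCutoff_eq_zero hR hx, deriv_deriv_horizontalCutoff_eq_zero hR hx,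
      indicator_of_notMem hx]
    simp

end Weight

section Lebesgue

variable {X : Type*} [MeasurableSpace X] {μ : Measure X}

lemma lintegral_le_of_tendsto {ι : Type*} {l : Filter ι} [l.NeBot] [l.IsCountablyGenerated]
    {F : ι → X → ℝ≥0∞} {f : X → ℝ≥0∞} {B : ι → ℝ≥0∞} {b : ℝ≥0∞}
    (hF : ∀ i, AEMeasurable (F i) μ) (hFf : ∀ᵐ x ∂μ, Tendsto (fun i => F i x) l (𝓝 (f x)))
    (hFB : ∀ᶠ i in l, ∫⁻ x, F i x ∂μ ≤ B i) (hB : Tendsto B l (𝓝 b)) : ∫⁻ x, f x ∂μ ≤ b :=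
  calc ∫⁻ x, f x ∂μ = ∫⁻ x, liminf (fun i => F i x) l ∂μ :=
        lintegral_congr_ae (hFf.mono fun _ hx => hx.liminf_eq.symm)
    _ ≤ liminf (fun i => ∫⁻ x, F i x ∂μ) l := lintegral_liminf_le' hF
    _ ≤ liminf B l := liminf_le_liminf hFB
    _ = b := hB.liminf_eq

lemma lintegral_ofReal_le_of_integral_sub_eq_zero {a b c : X → ℝ} (ha : Integrable a μ)
    (hb : Integrable b μ) (ha0 : 0 ≤ᵐ[μ] a) (hab : ∫ x, (a x - b x) ∂μ = 0) (hbc : b ≤ᵐ[μ] c) :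
    ∫⁻ x, ENNReal.ofReal (a x) ∂μ ≤ ∫⁻ x, ENNReal.ofReal (c x) ∂μ := by
  rw [integral_sub ha hb, sub_eq_zero] at hab
  calc ∫⁻ x, ENNReal.ofReal (a x) ∂μ = ENNReal.ofReal (∫ x, b x ∂μ) := by
        rw [← ofReal_integral_eq_lintegral_ofReal ha ha0, hab]
    _ ≤ ENNReal.ofReal (∫⁻ x, ENNReal.ofReal (b x) ∂μ).toReal := by
        rw [integral_eq_lintegral_pos_part_sub_lintegral_neg_part hb]
        exact ENNReal.ofReal_le_ofReal (sub_le_self _ ENNReal.toReal_nonneg)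
    _ ≤ ∫⁻ x, ENNReal.ofReal (b x) ∂μ := ENNReal.ofReal_toReal_le
    _ ≤ ∫⁻ x, ENNReal.ofReal (c x) ∂μ :=
        lintegral_mono_ae (hbc.mono fun _ h => ENNReal.ofReal_le_ofReal h)

lemma le_two_mul_of_le_mul_add {D k e : ℝ≥0∞} (hk : k ≤ 1 / 2) (hD : D ≠ ∞)
    (h : D ≤ k * D + e) : D ≤ 2 * e := by
  have hhalf : D / 2 + D / 2 ≤ D / 2 + e := by
    rw [ENNReal.add_halves]
    refine h.trans (add_le_add_left ((mul_le_mul_left hk D).trans_eq ?_) e)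
    rw [one_div, mul_comm, div_eq_mul_inv]
  rw [ENNReal.add_le_add_iff_left (ENNReal.div_ne_top hD two_ne_zero),
    ENNReal.div_le_iff two_ne_zero ENNReal.ofNat_ne_top] at hhalf
  rwa [mul_comm]

end Lebesgue

section ChannelIntegral

variable {F H : ℝ × ℝ → ℝ≥0∞}

lemma lintegral_openChannel (hF : AEMeasurable F (volume.restrict openChannel)) :
    ∫⁻ z in openChannel, F z = ∫⁻ x, ∫⁻ y in Ioo (-1) 1, F (x, y) := by
  have hprod : (volume : Measure (ℝ × ℝ)).restrict openChannel =
      (volume : Measure ℝ).prod ((volume : Measure ℝ).restrict (Ioo (-1) 1)) := by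
    rw [openChannel, Measure.volume_eq_prod, ← Measure.prod_restrict, Measure.restrict_univ]
  rw [hprod] at hF ⊢
  exact lintegral_prod _ hF

lemma lintegral_openChannel_mul_le {g : ℝ → ℝ≥0∞} {k : ℝ≥0∞} (hg : Measurable g)
    (hg' : ∀ x, g x ≠ ∞) (hF : AEMeasurable F (volume.restrict openChannel))
    (hH : AEMeasurable H (volume.restrict openChannel)) (hk : k ≠ ∞)
    (h : ∀ x, ∫⁻ y in Ioo (-1) 1, F (x, y) ≤ k * ∫⁻ y in Ioo (-1) 1, H (x, y)) :
    ∫⁻ z in openChannel, g z.1 * F z ≤ k * ∫⁻ z in openChannel, g z.1 * H z := by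
  have hg1 : AEMeasurable (fun z : ℝ × ℝ => g z.1) (volume.restrict openChannel) :=
    (hg.comp measurable_fst).aemeasurable
  rw [lintegral_openChannel (hg1.fun_mul hF), lintegral_openChannel (hg1.fun_mul hH),
    ← lintegral_const_mul' _ _ hk]
  refine lintegral_mono fun x => ?_
  rw [lintegral_const_mul' _ _ (hg' x), lintegral_const_mul' _ _ (hg' x), mul_left_comm]
  exact mul_le_mul_right (h x) _

lemma lintegral_openChannel_indicator_fst {R : ℝ} (hR : 0 ≤ R) (c : ℝ) :
    ∫⁻ z in openChannel, ENNReal.ofReal ((Icc (-(2 * R)) (2 * R)).indicator (fun _ => c) z.1) =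
      ENNReal.ofReal (8 * R * c) := by
  have hI : MeasurableSet (Icc (-(2 * R)) (2 * R)) := measurableSet_Icc
  have hcomp : (fun x => ENNReal.ofReal ((Icc (-(2 * R)) (2 * R)).indicator (fun _ => c) x)) =
      (Icc (-(2 * R)) (2 * R)).indicator fun _ => ENNReal.ofReal c :=
    (indicator_comp_of_zero ENNReal.ofReal_zero).symm
  have hmeas : Measurable fun x =>
      ENNReal.ofReal ((Icc (-(2 * R)) (2 * R)).indicator (fun _ => c) x) :=
    (measurable_const.indicator hI).ennreal_ofReal
  rw [lintegral_openChannel (hmeas.fun_comp measurable_fst).aemeasurable]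
  simp only [setLIntegral_const, Real.volume_Ioo]
  rw [lintegral_mul_const' _ _ ENNReal.ofReal_ne_top, hcomp, lintegral_indicator_const hI,
    Real.volume_Icc, mul_assoc, mul_comm, ← ENNReal.ofReal_mul (by linarith),
    ← ENNReal.ofReal_mul (by nlinarith)]
  congr 1
  ring

end ChannelIntegral

section EnergyInequality

variable {G ω ψ : ℝ × ℝ → ℝ} {δ ε R : ℝ}

lemma continuousOn_gradSq {u : ℝ × ℝ → ℝ} {U : Set (ℝ × ℝ)} (hu : ContDiffOn ℝ 1 u U)
    (hU : IsOpen U) : ContinuousOn (gradSq u) U :=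
  ((continuousOn_dirDeriv hu hU (1, 0)).pow 2).add ((continuousOn_dirDeriv hu hU (0, 1)).pow 2)

lemma gradSq_nonneg (u : ℝ × ℝ → ℝ) (z : ℝ × ℝ) : 0 ≤ gradSq u z := by
  unfold gradSq
  positivity

lemma aemeasurable_ofReal_of_continuousOn {E : Type*} [TopologicalSpace E] [MeasurableSpace E]
    [OpensMeasurableSpace E] {μ : Measure E} {U : Set E} {f : E → ℝ} (hf : ContinuousOn f U)
    (hU : IsOpen U) : AEMeasurable (fun z => ENNReal.ofReal (f z)) (μ.restrict U) :=
  (hf.aemeasurable hU.measurableSet).ennreal_ofReal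

lemma integrable_mul_of_tsupport_subset {E : Type*} [NormedAddCommGroup E] [NormedSpace ℝ E]
    [MeasurableSpace E] [OpensMeasurableSpace E] {μ : Measure E} [IsFiniteMeasureOnCompacts μ]
    {U : Set E} {g q : E → ℝ} (hU : IsOpen U) (hg : Continuous g) (hgc : HasCompactSupport g)
    (hgU : tsupport g ⊆ U) (hq : ContinuousOn q U) : Integrable (fun z => g z * q z) μ := by
  have hcont : Continuous fun z => g z * q z :=
    contDiff_zero.1 (contDiff_of_contDiffOn_of_tsupport_subset hU
      (contDiffOn_zero.2 (hg.continuousOn.mul hq)) ((tsupport_mul_subset_left).trans hgU))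
  exact hcont.integrable_of_hasCompactSupport hgc.mul_right

namespace IsStreamFunction

variable (hψ : IsStreamFunction ω ψ)
include hψ

lemma lintegral_energy_le (hω : ContDiffOn ℝ 1 ω openChannel) (hG : ContDiff ℝ 2 G)
    (hG0 : ∀ z, 0 ≤ G z) (hGc : HasCompactSupport G) (hGU : tsupport G ⊆ openChannel) :
    ∫⁻ z in openChannel, ENNReal.ofReal (G z * gradSq (dx ψ) z) ≤
      ∫⁻ z in openChannel,
        ENNReal.ofReal (G z * |dx ψ z * dx ω z| + dx ψ z ^ 2 * |lap G z|) := by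
  have hφ := hψ.contDiffOn_dx.continuousOn
  have hω' : ContinuousOn (dx ω) openChannel := continuousOn_dirDeriv hω isOpen_openChannel (1, 0)
  have hlap : tsupport (lap G) ⊆ tsupport G := tsupport_lap_subset G
  have hint {q} (hq : ContinuousOn q openChannel) : IntegrableOn (fun z => G z * q z) openChannel :=
    (integrable_mul_of_tsupport_subset isOpen_openChannel hG.continuous hGc hGU hq).integrableOn
  have hint_lap : IntegrableOn (fun z => lap G z * dx ψ z ^ 2) openChannel :=
    (integrable_mul_of_tsupport_subset isOpen_openChannel (continuous_lap hG)
      (hGc.of_isClosed_subset (isClosed_tsupport _) hlap) (hlap.trans hGU) (hφ.pow 2)).integrableOn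
  refine lintegral_ofReal_le_of_integral_sub_eq_zero
    (b := fun z => G z * (dx ψ z * dx ω z) + 1 / 2 * (lap G z * dx ψ z ^ 2))
    (hint (continuousOn_gradSq hψ.contDiffOn_dx isOpen_openChannel))
    ((hint (hφ.fun_mul hω')).fun_add (hint_lap.const_mul _))
    (ae_of_all _ fun z => mul_nonneg (hG0 z) (gradSq_nonneg _ z)) ?_ (ae_of_all _ fun z => ?_)
  · calc ∫ z in openChannel, (G z * gradSq (dx ψ) z
          - (G z * (dx ψ z * dx ω z) + 1 / 2 * (lap G z * dx ψ z ^ 2)))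
        = ∫ z in openChannel, 1 / 2 * energyDensity G (dx ω) (dx ψ) z := by
          congr 1 with z
          rw [energyDensity]
          ring
      _ = 1 / 2 * ∫ z, energyDensity G (dx ω) (dx ψ) z := by
          rw [integral_const_mul, setIntegral_eq_integral_of_forall_compl_eq_zero fun z hz =>
            energyDensity_eq_zero_of_notMem_tsupport (fun h => hz (hGU h)) _ _]
      _ = 0 := by rw [integral_energyDensity_dx_eq_zero hψ hω hG hGc hGU, mul_zero]
  · have hbulk := mul_le_mul_of_nonneg_left (le_abs_self (dx ψ z * dx ω z)) (hG0 z)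
    have hcut := mul_le_mul_of_nonneg_left (le_abs_self (lap G z)) (sq_nonneg (dx ψ z))
    have := mul_nonneg (sq_nonneg (dx ψ z)) (abs_nonneg (lap G z))
    dsimp only
    linarith

lemma aemeasurable_sq_mul_abs_lap_weight (R m : ℝ) : AEMeasurable
    (fun z => ENNReal.ofReal (dx ψ z ^ 2 * |lap (weight R m) z|)) (volume.restrict openChannel) :=
  aemeasurable_ofReal_of_continuousOn ((hψ.contDiffOn_dx.continuousOn.fun_pow 2).fun_mul
    (continuous_lap (contDiff_weight R m)).abs.continuousOn) isOpen_openChannel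

variable (hδ : ∀ z ∈ openChannel, |dx ψ z| ≤ δ * (1 - z.2 ^ 2)) (hR : 0 < R)
include hδ hR

lemma tendsto_lintegral_sq_mul_abs_lap_weight : Tendsto
    (fun m => ∫⁻ z in openChannel, ENNReal.ofReal (dx ψ z ^ 2 * |lap (weight R m) z|)) atTop
    (𝓝 (∫⁻ z in openChannel,
      ENNReal.ofReal (dx ψ z ^ 2 * |deriv (deriv (horizontalCutoff R)) z.1|))) := by
  obtain ⟨C, hC⟩ := exists_abs_deriv_smoothTransition_le
  refine tendsto_lintegral_filter_of_dominated_convergence' (fun z => ENNReal.ofReal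
    ((Icc (-(2 * R)) (2 * R)).indicator (fun _ => δ ^ 2 * (10 * C * R⁻¹ ^ 2 + 24 * C)) z.1))
    (Eventually.of_forall fun m => ?_) ?_ ?_ ?_
  · exact hψ.aemeasurable_sq_mul_abs_lap_weight R m
  · filter_upwards [eventually_ge_atTop 0] with m hm
    filter_upwards [ae_restrict_mem isOpen_openChannel.measurableSet] with z hz
    exact ENNReal.ofReal_le_ofReal (sq_mul_abs_lap_weight_le hC hR hm hz (hδ z hz))
  · rw [lintegral_openChannel_indicator_fst hR.le]
    exact ENNReal.ofReal_ne_top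
  · filter_upwards [ae_restrict_mem isOpen_openChannel.measurableSet] with z hz
    refine tendsto_const_nhds.congr' ?_
    filter_upwards [eventually_lap_weight_eq R hz] with m hm
    rw [hm]

lemma lintegral_horizontalCutoff_energy_le (hω : ContDiffOn ℝ 1 ω openChannel) :
    ∫⁻ z in openChannel, ENNReal.ofReal (horizontalCutoff R z.1 * gradSq (dx ψ) z) ≤
      (∫⁻ z in openChannel, ENNReal.ofReal (horizontalCutoff R z.1 * |dx ψ z * dx ω z|)) +
      ∫⁻ z in openChannel,
        ENNReal.ofReal (dx ψ z ^ 2 * |deriv (deriv (horizontalCutoff R)) z.1|) := by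
  refine lintegral_le_of_tendsto (l := atTop)
    (F := fun m z => ENNReal.ofReal (weight R m z * gradSq (dx ψ) z))
    (fun m => aemeasurable_ofReal_of_continuousOn ((contDiff_weight R m).continuous.continuousOn.mul
      (continuousOn_gradSq hψ.contDiffOn_dx isOpen_openChannel)) isOpen_openChannel) ?_ ?_
    ((hψ.tendsto_lintegral_sq_mul_abs_lap_weight hδ hR).const_add _)
  · filter_upwards [ae_restrict_mem isOpen_openChannel.measurableSet] with z hz
    refine tendsto_const_nhds.congr' ?_
    filter_upwards [eventually_weight_eq R hz] with m hm
    rw [hm]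
  · filter_upwards [eventually_gt_atTop 0] with m hm
    refine (hψ.lintegral_energy_le hω (contDiff_weight R m) (weight_nonneg R m)
      (hasCompactSupport_weight hR hm) (tsupport_weight_subset_openChannel hR hm)).trans ?_
    rw [← lintegral_add_right' _ (hψ.aemeasurable_sq_mul_abs_lap_weight R m)]
    refine lintegral_mono fun z => ENNReal.ofReal_add_le.trans (add_le_add ?_ le_rfl)
    exact ENNReal.ofReal_le_ofReal
      (mul_le_mul_of_nonneg_right (weight_le_horizontalCutoff R m z) (abs_nonneg _))

end IsStreamFunction

end EnergyInequality

section Absorption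

variable {ω ψ : ℝ × ℝ → ℝ} {ε R : ℝ} {k : ℝ≥0∞}

lemma lintegral_openChannel_le_of_le_indicator {F : ℝ × ℝ → ℝ} {c : ℝ} (hR : 0 ≤ R)
    (h : ∀ z ∈ openChannel, F z ≤ (Icc (-(2 * R)) (2 * R)).indicator (fun _ => c) z.1) :
    ∫⁻ z in openChannel, ENNReal.ofReal (F z) ≤ ENNReal.ofReal (8 * R * c) := by
  rw [← lintegral_openChannel_indicator_fst hR]
  exact setLIntegral_mono' isOpen_openChannel.measurableSet fun z hz =>
    ENNReal.ofReal_le_ofReal (h z hz)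

namespace IsStreamFunction

variable (hψ : IsStreamFunction ω ψ) (hω : ContDiffOn ℝ 1 ω openChannel)
  (hdx : ∀ z ∈ openChannel, |dx ω z| ≤ ε)
include hψ hω hdx

lemma abs_dx_le_half {z : ℝ × ℝ} (hz : z ∈ openChannel) : |dx ψ z| ≤ ε / 2 := by
  have hε : 0 ≤ ε := (abs_nonneg _).trans (hdx z hz)
  have := hψ.abs_dx_le hω hdx hz
  nlinarith [mul_nonneg hε (sq_nonneg z.2)]

lemma lintegral_horizontalCutoff_source_ne_top (hR : 0 < R) :
    ∫⁻ z in openChannel, ENNReal.ofReal (horizontalCutoff R z.1 * |dx ψ z * dx ω z|) ≠ ∞ := by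
  refine ne_top_of_le_ne_top ENNReal.ofReal_ne_top
    (lintegral_openChannel_le_of_le_indicator (c := ε / 2 * ε) hR.le fun z hz => ?_)
  by_cases hx : z.1 ∈ Icc (-(2 * R)) (2 * R)
  · rw [indicator_of_mem hx, abs_mul]
    refine (mul_le_of_le_one_left (by positivity) (cutoff_le_one _ _ _)).trans ?_
    exact mul_le_mul (hψ.abs_dx_le_half hω hdx hz) (hdx z hz) (abs_nonneg _)
      ((abs_nonneg _).trans (hψ.abs_dx_le_half hω hdx hz))
  · rw [indicator_of_notMem hx, horizontalCutoff_eq_zero hR hx, zero_mul]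

lemma exists_lintegral_cutoffError_le : ∃ C : ℝ, ∀ R > 0, ∫⁻ z in openChannel,
    ENNReal.ofReal (dx ψ z ^ 2 * |deriv (deriv (horizontalCutoff R)) z.1|) ≤
      ENNReal.ofReal (C * R⁻¹) := by
  obtain ⟨C, hC⟩ := exists_abs_deriv_smoothTransition_le
  refine ⟨20 * C * ε ^ 2, fun R hR => (lintegral_openChannel_le_of_le_indicator
    (c := (ε / 2) ^ 2 * (10 * C * R⁻¹ ^ 2)) hR.le fun z hz => ?_).trans_eq ?_⟩
  · by_cases hx : z.1 ∈ Icc (-(2 * R)) (2 * R)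
    · rw [indicator_of_mem hx, ← sq_abs (dx ψ z)]
      gcongr
      · exact hψ.abs_dx_le_half hω hdx hz
      · exact abs_deriv_deriv_horizontalCutoff_le hC R z.1
    · rw [indicator_of_notMem hx, deriv_deriv_horizontalCutoff_eq_zero hR hx, abs_zero, mul_zero]
  · congr 1
    field_simp
    ring

variable (hk : k ≤ 1 / 2)
  (hslice : ∀ x, ∫⁻ y in Ioo (-1) 1, ENNReal.ofReal |dx ψ (x, y) * dx ω (x, y)| ≤
    k * ∫⁻ y in Ioo (-1) 1, ENNReal.ofReal (gradSq (dx ψ) (x, y)))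
include hk hslice

lemma lintegral_horizontalCutoff_energy_le_of_slice (hR : 0 < R) :
    ∫⁻ z in openChannel, ENNReal.ofReal (horizontalCutoff R z.1 * gradSq (dx ψ) z) ≤
      2 * ∫⁻ z in openChannel,
        ENNReal.ofReal (dx ψ z ^ 2 * |deriv (deriv (horizontalCutoff R)) z.1|) := by
  obtain ⟨C, hC⟩ := hψ.exists_lintegral_cutoffError_le hω hdx
  have henergy := hψ.lintegral_horizontalCutoff_energy_le (fun z => hψ.abs_dx_le hω hdx) hR hω
  have hfin := ne_top_of_le_ne_top (ENNReal.add_ne_top.2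
    ⟨hψ.lintegral_horizontalCutoff_source_ne_top hω hdx hR,
      ne_top_of_le_ne_top ENNReal.ofReal_ne_top (hC R hR)⟩) henergy
  refine le_two_mul_of_le_mul_add hk hfin (henergy.trans (add_le_add ?_ le_rfl))
  simp only [ENNReal.ofReal_mul (show 0 ≤ horizontalCutoff R _ from cutoff_nonneg _ _ _)]
  exact lintegral_openChannel_mul_le (g := fun x => ENNReal.ofReal (horizontalCutoff R x))
    (contDiff_cutoff _ _).continuous.measurable.ennreal_ofReal (fun x => ENNReal.ofReal_ne_top)
    (aemeasurable_ofReal_of_continuousOn (hψ.contDiffOn_dx.continuousOn.fun_mul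
      (continuousOn_dirDeriv hω isOpen_openChannel (1, 0))).abs isOpen_openChannel)
    (aemeasurable_ofReal_of_continuousOn
      (continuousOn_gradSq hψ.contDiffOn_dx isOpen_openChannel) isOpen_openChannel)
    (ne_top_of_le_ne_top (by simp) hk) hslice

lemma lintegral_gradSq_dx_eq_zero :
    ∫⁻ z in openChannel, ENNReal.ofReal (gradSq (dx ψ) z) = 0 := by
  obtain ⟨C, hC⟩ := hψ.exists_lintegral_cutoffError_le hω hdx
  have hlim : Tendsto (fun R : ℝ => 2 * ENNReal.ofReal (C * R⁻¹)) atTop (𝓝 0) := by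
    have := ENNReal.tendsto_ofReal (tendsto_inv_atTop_zero.const_mul C)
    rw [mul_zero, ENNReal.ofReal_zero] at this
    simpa using ENNReal.Tendsto.const_mul this (Or.inr ENNReal.ofNat_ne_top)
  refine nonpos_iff_eq_zero.1 (lintegral_le_of_tendsto
    (F := fun R z => ENNReal.ofReal (horizontalCutoff R z.1 * gradSq (dx ψ) z)) (fun R =>
      aemeasurable_ofReal_of_continuousOn (((contDiff_cutoff _ _).continuous.comp
        continuous_fst).continuousOn.mul (continuousOn_gradSq hψ.contDiffOn_dx isOpen_openChannel))
        isOpen_openChannel) (ae_of_all _ fun z => ?_) ?_ hlim)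
  · refine tendsto_const_nhds.congr' ?_
    filter_upwards [eventually_horizontalCutoff_eq_one z.1] with R hR
    rw [hR, one_mul]
  · filter_upwards [eventually_gt_atTop 0] with R hR
    exact (hψ.lintegral_horizontalCutoff_energy_le_of_slice hω hdx hk hslice hR).trans
      (mul_le_mul_right (hC R hR) 2)

lemma gradSq_dx_eq_zero {z : ℝ × ℝ} (hz : z ∈ openChannel) : gradSq (dx ψ) z = 0 := by
  have hcont := continuousOn_gradSq hψ.contDiffOn_dx isOpen_openChannel
  have hae : gradSq (dx ψ) =ᵐ[volume.restrict openChannel] fun _ => 0 := by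
    filter_upwards [(lintegral_eq_zero_iff' (aemeasurable_ofReal_of_continuousOn hcont
      isOpen_openChannel)).1 (hψ.lintegral_gradSq_dx_eq_zero hω hdx hk hslice)] with z hz
    exact le_antisymm (ENNReal.ofReal_eq_zero.1 hz) (gradSq_nonneg _ z)
  exact Measure.eqOn_open_of_ae_eq hae isOpen_openChannel hcont continuousOn_const hz

end IsStreamFunction

end Absorption

section HolderBounds

variable {α ε : ℝ} {ω : ℝ × ℝ → ℝ} {z : ℝ × ℝ}

lemma abs_fst_le_euclid (v : ℝ × ℝ) : |v.1| ≤ euclid v :=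
  Real.abs_le_sqrt (le_add_of_nonneg_right (sq_nonneg _))

lemma abs_snd_le_euclid (v : ℝ × ℝ) : |v.2| ≤ euclid v :=
  Real.abs_le_sqrt (le_add_of_nonneg_left (sq_nonneg _))

variable (hε : 0 ≤ ε) (hω : holderNorm α ω ≤ ENNReal.ofReal ε)
include hε hω

lemma abs_le_of_holderNorm_le (hz : z ∈ channel) : |ω z| ≤ ε := by
  refine (ENNReal.ofReal_le_ofReal_iff hε).1 (le_trans ?_ hω)
  exact (le_iSup₂ (f := fun z (_ : z ∈ channel) => ENNReal.ofReal |ω z|) z hz).trans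
    (le_self_add.trans le_self_add)

lemma euclid_grad_le_of_holderNorm_le (hz : z ∈ openChannel) : euclid (grad ω z) ≤ ε := by
  refine (ENNReal.ofReal_le_ofReal_iff hε).1 (le_trans ?_ hω)
  exact (le_iSup₂ (f := fun z (_ : z ∈ openChannel) => ENNReal.ofReal (euclid (grad ω z)))
    z hz).trans (le_add_self.trans le_self_add)

lemma abs_dx_le_of_holderNorm_le (hz : z ∈ openChannel) : |dx ω z| ≤ ε :=
  (abs_fst_le_euclid (grad ω z)).trans (euclid_grad_le_of_holderNorm_le hε hω hz)

lemma abs_dy_le_of_holderNorm_le (hz : z ∈ openChannel) : |dy ω z| ≤ ε :=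
  (abs_snd_le_euclid (grad ω z)).trans (euclid_grad_le_of_holderNorm_le hε hω hz)

lemma abs_dy_sub_le_of_holderNorm_le {z' : ℝ × ℝ} (hz : z ∈ openChannel) (hz' : z' ∈ openChannel)
    (hne : z ≠ z') : |dy ω z - dy ω z'| ≤ ε * euclid (z - z') ^ α := by
  have hquot : euclid (grad ω z - grad ω z') / euclid (z - z') ^ α ≤ ε := by
    refine (ENNReal.ofReal_le_ofReal_iff hε).1 (le_trans ?_ hω)
    refine le_trans ?_ le_add_self
    refine le_trans ?_ (le_iSup₂ z hz)
    refine le_trans ?_ (le_iSup₂ z' hz')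
    exact le_iSup (fun _ : z ≠ z' => ENNReal.ofReal
      (euclid (grad ω z - grad ω z') / euclid (z - z') ^ α)) hne
  have hpos : 0 < euclid (z - z') := by
    by_contra! h
    have hfst := abs_nonpos_iff.1 ((abs_fst_le_euclid (z - z')).trans h)
    have hsnd := abs_nonpos_iff.1 ((abs_snd_le_euclid (z - z')).trans h)
    exact hne (sub_eq_zero.1 (Prod.ext hfst hsnd))
  exact (abs_snd_le_euclid (grad ω z - grad ω z')).trans
    ((div_le_iff₀ (Real.rpow_pos_of_pos hpos α)).1 hquot)

end HolderBounds

section TravelingWave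

variable {c : ℝ} {ω : ℝ × ℝ → ℝ}

namespace IsTravelingWave

lemma contDiffOn (h : IsTravelingWave c ω) : ContDiffOn ℝ 1 ω openChannel := by
  have hslice := h.1.comp (f := fun z : ℝ × ℝ => ((0 : ℝ), z)) (s := openChannel)
    (by fun_prop) fun z hz => ⟨mem_univ _, hz⟩
  simpa [Function.comp_def] using hslice

lemma exists_isStreamFunction (h : IsTravelingWave c ω) : ∃ ψ, IsStreamFunction ω ψ ∧
    ∀ z ∈ openChannel, (z.2 - c + dy ψ z) * dx ω z = dx ψ z * dy ω z := by
  obtain ⟨-, ψ, hψ, heuler⟩ := id h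
  have hprofile : (fun z : ℝ × ℝ => ω (z.1 - c * 0, z.2)) = ω := by
    simp
  have hψ0 := hψ 0
  simp only [hprofile] at hψ0
  refine ⟨ψ 0, hψ0, fun z hz => ?_⟩
  have htime : HasDerivAt (fun τ : ℝ => ω (z.1 - c * τ, z.2)) (-c * dx ω z) 0 := by
    have hshift : HasDerivAt (fun τ : ℝ => -c * τ) (-c) 0 := by
      simpa using (hasDerivAt_id (0 : ℝ)).const_mul (-c)
    have hline := hasDerivAt_horizontal h.contDiffOn hz (-c * 0)
    have hchain := hline.comp (0 : ℝ) hshift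
    simpa [Function.comp_def, Prod.add_def, sub_eq_add_neg, mul_comm] using hchain
  have hz_euler := heuler 0 z hz
  simp only [hprofile, velocity, htime.deriv] at hz_euler
  linarith

end IsTravelingWave

end TravelingWave

section Rigidity

variable {α c ε : ℝ} {f ω ψ : ℝ × ℝ → ℝ} {z : ℝ × ℝ}

lemma hasDerivAt_vertical (hf : ContDiffOn ℝ 1 f openChannel) {x y : ℝ}
    (hy : y ∈ Ioo (-1 : ℝ) 1) : HasDerivAt (fun s : ℝ => f (x, s)) (dy f (x, y)) y := by
  have hline := hasDerivAt_line (f := f) (z := (x, 0)) (v := (0, 1)) (t := y)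
    (differentiableAt_of_contDiffOn hf isOpen_openChannel one_ne_zero
      (by simpa [mem_openChannel] using hy))
  simpa [dy_eq_dirDeriv] using hline

lemma tendsto_vertical_of_abs_le {δ b : ℝ} {l : Filter ℝ}
    (hf : ∀ z ∈ openChannel, |f z| ≤ δ * (1 - z.2 ^ 2)) (x : ℝ) (hb : b ^ 2 = 1) (hl : l ≤ 𝓝 b)
    (hIoo : Ioo (-1) 1 ∈ l) : Tendsto (fun y => f (x, y)) l (𝓝 0) := by
  have hbound : Tendsto (fun y : ℝ => δ * (1 - y ^ 2)) l (𝓝 (δ * (1 - b ^ 2))) :=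
    ((by fun_prop : Continuous fun y : ℝ => δ * (1 - y ^ 2)).tendsto b).mono_left hl
  rw [hb, sub_self, mul_zero] at hbound
  exact squeeze_zero_norm' (mem_of_superset hIoo fun y hy => hf (x, y) (mem_openChannel.2 hy))
    hbound

lemma IsStreamFunction.lintegral_abs_dx_mul_dx_le (hψ : IsStreamFunction ω ψ)
    (hω : ContDiffOn ℝ 1 ω openChannel)
    (heq : ∀ z ∈ openChannel, (z.2 - c + dy ψ z) * dx ω z = dx ψ z * dy ω z)
    (hε : 0 < ε) (hε4 : ε ≤ 1 / 4) (hn : holderNorm α ω ≤ ENNReal.ofReal ε) (x : ℝ) :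
    ∫⁻ y in Ioo (-1) 1, ENNReal.ofReal |dx ψ (x, y) * dx ω (x, y)| ≤
      ENNReal.ofReal (2 * ε) * sliceConst α 2 *
        ∫⁻ y in Ioo (-1) 1, ENNReal.ofReal (dy (dx ψ) (x, y) ^ 2) := by
  have hdx (z) (hz : z ∈ openChannel) : |dx ω z| ≤ ε := abs_dx_le_of_holderNorm_le hε.le hn hz
  have hsup (z) (hz : z ∈ openChannel) : |ω z| ≤ ε :=
    abs_le_of_holderNorm_le hε.le hn (openChannel_subset_channel hz)
  have hφ (z) (hz : z ∈ openChannel) := hψ.abs_dx_le hω hdx hz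
  have hmem {y : ℝ} (hy : y ∈ Ioo (-1) 1) : (x, y) ∈ openChannel := mem_openChannel.2 hy
  rw [show 2 * ε = ε / (1 / 2) by ring, show sliceConst α 2 = sliceConst α (1 - -1) by norm_num]
  refine lintegral_abs_mul_le_sliceConst (p := fun y => y - c + dy ψ (x, y))
    (p' := fun y => 1 + dy (dy ψ) (x, y)) (r := fun y => dy ω (x, y)) (by norm_num) hε
    (by norm_num) (fun y hy => hasDerivAt_vertical hψ.contDiffOn_dx hy)
    ((continuousOn_dirDeriv hψ.contDiffOn_dx isOpen_openChannel (0, 1)).comp (by fun_prop)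
      fun y hy => hmem hy)
    (tendsto_vertical_of_abs_le hφ x (by norm_num) nhdsWithin_le_nhds
      (Ioo_mem_nhdsGT (by norm_num)))
    (tendsto_vertical_of_abs_le hφ x (by norm_num) nhdsWithin_le_nhds
      (Ioo_mem_nhdsLT (by norm_num)))
    (fun y hy => ((hasDerivAt_id y).sub_const c).add (hasDerivAt_vertical hψ.contDiffOn_dy hy))
    (fun y hy => ?_) (fun y hy => heq _ (hmem hy))
    (fun y hy => abs_dy_le_of_holderNorm_le hε.le hn (hmem hy)) (fun y hy y' hy' hne => ?_)
  · linarith [(abs_le.1 (hψ.abs_dy_dy_le hω hdx hsup (hmem hy))).1]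
  · have hdist : euclid ((x, y) - (x, y')) = |y - y'| := by
      simp [euclid, Real.sqrt_sq_eq_abs]
    rw [← hdist]
    exact abs_dy_sub_le_of_holderNorm_le hε.le hn (hmem hy) (hmem hy') (by simpa using hne)

lemma IsStreamFunction.dx_eq_zero_of_gradSq_dx (hψ : IsStreamFunction ω ψ)
    (hφ : ∀ z ∈ openChannel, |dx ψ z| ≤ ε * (1 - z.2 ^ 2))
    (hgrad : ∀ z ∈ openChannel, gradSq (dx ψ) z = 0) (hz : z ∈ openChannel) : dx ψ z = 0 := by
  have hdy (z) (hz : z ∈ openChannel) : dy (dx ψ) z = 0 :=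
    pow_eq_zero_iff two_ne_zero |>.1
      ((add_eq_zero_iff_of_nonneg (sq_nonneg _) (sq_nonneg _)).1 (hgrad z hz)).2
  have hvertical : ∀ y ∈ Ioo (-1) 1, dx ψ z = dx ψ (z.1, y) := fun y hy =>
    isOpen_Ioo.is_const_of_deriv_eq_zero (f := fun s => dx ψ (z.1, s)) isPreconnected_Ioo
      (fun s hs =>
        (hasDerivAt_vertical hψ.contDiffOn_dx hs).differentiableAt.differentiableWithinAt)
      (fun s hs => (hasDerivAt_vertical hψ.contDiffOn_dx hs).deriv.trans
        (hdy _ (mem_openChannel.2 hs))) (mem_openChannel.1 hz) hy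
  have hIoo : Ioo (-1) 1 ∈ 𝓝[<] (1 : ℝ) := Ioo_mem_nhdsLT (by norm_num)
  exact tendsto_nhds_unique
    (tendsto_const_nhds.congr' (mem_of_superset hIoo hvertical))
    (tendsto_vertical_of_abs_le hφ z.1 (one_pow 2) nhdsWithin_le_nhds hIoo)

lemma IsStreamFunction.translate_vorticity_eq (hψ : IsStreamFunction ω ψ)
    (hdx : ∀ z ∈ openChannel, dx ψ z = 0) (t : ℝ) (hz : z ∈ openChannel) :
    ω (z + (t, 0)) = ω z := by
  have hinv : EqOn (fun z => ψ (z + (t, 0))) ψ openChannel := fun z hz => by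
    have hderiv (s : ℝ) := hasDerivAt_horizontal hψ.contDiffOn_one hz s
    have hconst := is_const_of_deriv_eq_zero (fun s => (hderiv s).differentiableAt)
      (fun s => by rw [(hderiv s).deriv, hdx _ (add_mem_openChannel s hz)]) t 0
    simpa only [Prod.mk_zero_zero, add_zero] using hconst
  have hlap : lap (fun z => ψ (z + (t, 0))) z = lap ψ z := lap_congr isOpen_openChannel hinv hz
  rwa [(hψ.translate t).lap_eq hz, hψ.lap_eq hz, neg_inj] at hlap

lemma exists_pos_forall_translate_eq (hα : 0 < α) : ∃ ε : ℝ, 0 < ε ∧ ∀ (c : ℝ) (ω : ℝ × ℝ → ℝ),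
    IsTravelingWave c ω → holderNorm α ω ≤ ENNReal.ofReal ε →
      ∀ t : ℝ, ∀ z ∈ openChannel, ω (z + (t, 0)) = ω z := by
  have hsmall : ∀ᶠ ε in 𝓝 (0 : ℝ), ENNReal.ofReal (2 * ε) * sliceConst α 2 < 1 / 2 := by
    have hcont : Continuous fun ε => ENNReal.ofReal (2 * ε) * sliceConst α 2 :=
      (ENNReal.continuous_mul_const (sliceConst_ne_top hα _)).comp
        (ENNReal.continuous_ofReal.comp (by fun_prop))
    exact hcont.tendsto 0 |>.eventually_lt_const (by simp)
  obtain ⟨ε, hk, hε, hε4⟩ := ((hsmall.filter_mono nhdsWithin_le_nhds).and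
    (Ioc_mem_nhdsGT (show (0 : ℝ) < 1 / 4 by norm_num))).exists
  refine ⟨ε, hε, fun c ω htw hn t z hz => ?_⟩
  have hω := htw.contDiffOn
  have hdx (z) (hz : z ∈ openChannel) : |dx ω z| ≤ ε := abs_dx_le_of_holderNorm_le hε.le hn hz
  obtain ⟨ψ, hψ, heq⟩ := htw.exists_isStreamFunction
  refine hψ.translate_vorticity_eq (fun z hz => hψ.dx_eq_zero_of_gradSq_dx
    (fun z hz => hψ.abs_dx_le hω hdx hz) (fun z hz => ?_) hz) t hz
  refine hψ.gradSq_dx_eq_zero hω hdx hk.le (fun x => ?_) hz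
  refine (hψ.lintegral_abs_dx_mul_dx_le hω heq hε hε4 hn x).trans ?_
  gcongr
  exact le_add_of_nonneg_left (sq_nonneg _)

lemma lintegral_openChannel_eq_zero_of_translate_eq {F : ℝ × ℝ → ℝ≥0∞}
    (hF : AEMeasurable F (volume.restrict openChannel)) (hfin : ∫⁻ z in openChannel, F z ≠ ∞)
    (hinv : ∀ t : ℝ, ∀ z ∈ openChannel, F (z + (t, 0)) = F z) : ∫⁻ z in openChannel, F z = 0 := by
  have hslice (x : ℝ) : ∫⁻ y in Ioo (-1) 1, F (x, y) = ∫⁻ y in Ioo (-1) 1, F (0, y) :=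
    setLIntegral_congr_fun measurableSet_Ioo fun y hy => by
      simpa using hinv x (0, y) (mem_openChannel.2 hy)
  rw [lintegral_openChannel hF] at hfin ⊢
  simp only [hslice, lintegral_const, Real.volume_univ] at hfin ⊢
  by_contra hne
  exact hfin (ENNReal.mul_top fun h => hne (by rw [h, zero_mul]))

lemma eq_zero_of_memLp_of_translate_eq {p : ℝ≥0∞} (hc : ContinuousOn ω channel) (hp0 : p ≠ 0)
    (hp : p ≠ ∞) (hLp : MemLp ω p (volume.restrict channel))
    (hinv : ∀ t : ℝ, ∀ z ∈ openChannel, ω (z + (t, 0)) = ω z) (hz : z ∈ channel) : ω z = 0 := by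
  have hLp' : MemLp ω p (volume.restrict openChannel) :=
    hLp.mono_measure (Measure.restrict_mono openChannel_subset_channel le_rfl)
  have hpow : AEMeasurable (fun z => ‖ω z‖ₑ ^ p.toReal) (volume.restrict openChannel) :=
    hLp'.aestronglyMeasurable.enorm.pow_const _
  have hzero := lintegral_openChannel_eq_zero_of_translate_eq hpow
    (lintegral_rpow_enorm_lt_top_of_eLpNorm_lt_top hp0 hp hLp'.eLpNorm_lt_top).ne
    fun t z hz => by rw [hinv t z hz]
  have hae : ω =ᵐ[volume.restrict openChannel] fun _ => 0 := by
    filter_upwards [(lintegral_eq_zero_iff' hpow).1 hzero] with z hz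
    exact enorm_eq_zero.1 ((ENNReal.rpow_eq_zero_iff_of_pos (ENNReal.toReal_pos hp0 hp)).1 hz)
  have hopen : EqOn ω (fun _ => 0) openChannel := Measure.eqOn_open_of_ae_eq hae
    isOpen_openChannel (hc.mono openChannel_subset_channel) continuousOn_const
  refine hopen.of_subset_closure hc continuousOn_const openChannel_subset_channel ?_ hz
  rw [openChannel, closure_prod_eq, closure_univ, closure_Ioo (by norm_num)]
  exact subset_rfl

end Rigidity

end Couette

end

theorem mainTheorem5_general (α : ℝ) (hα : 0 < α) :
    ∃ ε : ℝ, 0 < ε ∧ ∀ (p : ℝ≥0∞) (c : ℝ) (ω : ℝ × ℝ → ℝ), p ≠ 0 → p ≠ ∞ →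
      MemLp ω p (volume.restrict Couette.channel) →
      ContinuousOn ω Couette.channel →
      Couette.IsTravelingWave c ω →
      Couette.holderNorm α ω ≤ ENNReal.ofReal ε →
      ∀ z ∈ Couette.channel, ω z = 0 := by
  obtain ⟨ε, hε, hinv⟩ := Couette.exists_pos_forall_translate_eq hα
  exact ⟨ε, hε, fun p c ω hp0 hp hLp hω htw hn z hz =>
    Couette.eq_zero_of_memLp_of_translate_eq hω hp0 hp hLp (hinv c ω htw hn) hz⟩

theorem mainTheorem5 (α : ℝ) (hα : 0 < α) :
    ∃ ε : ℝ, 0 < ε ∧ ∀ (c : ℝ) (ω : ℝ × ℝ → ℝ),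
      MemLp ω 2 (volume.restrict Couette.channel) →
      Couette.MemHolder α ω →
      Couette.IsTravelingWave c ω →
      Couette.holderNorm α ω ≤ ENNReal.ofReal ε →
      ∀ z ∈ Couette.channel, ω z = 0 := by
  obtain ⟨ε, hε, h⟩ := mainTheorem5_general α hα
  exact ⟨ε, hε, fun c ω hL2 hω => h 2 c ω two_ne_zero ENNReal.ofNat_ne_top hL2 hω.continuousOn⟩
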